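/- Let $G=(\mathcal V,\mathcal E)$ be an infinite (simple, not necessarily connected) graph in which every vertex $v$ has finite degree $|v|\ge 1$, and let $d\in\mathbb N$. Suppose $\mathbb Z^d$ acts freely on $\mathcal V$ by graph automorphisms $T_\gamma$, $\gamma\in\mathbb Z^d$, and that $Q\subset\mathcal V$ is a finite fundamental domain, i.e. a finite set containing exactly one vertex of each orbit. The Laplacian is $$(\Delta f)(v)=f(v)-\frac1{|v|}\sum_{w\sim v}f(w),\qquad f:\mathcal V\to\mathbb C .$$ It defines a bounded self-adjoint operator on $\ell^2(\mathcal V,\deg)$, the Hilbert space with inner product $\sum_{v}|v|\,f(v)\overline{g(v)}$ (as a set this is $\ell^2(\mathcal V)$, and if $G$ is regular its inner product is a constant multiple of the one of $\ell^2(\mathcal V)$). The integrated density of states is $$N_G(E)=\frac1{|Q|}\operatorname{Tr}\bigl(\chi_Q\,\chi_{(-\infty,E]}(\Delta)\bigr),\qquad E\in\mathbb R,$$ where $\chi_{(-\infty,E]}(\Delta)$ is the spectral projector and $\chi_Q$ is multiplication by the indicator function of $Q$. For $\theta\in\mathbb T^d=\mathbb R^d/(2\pi\mathbb Z)^d$ let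 $\Delta^\theta$ be the restriction of $\Delta$ to the $|Q|$-dimensional space $$\ell^2(\mathcal V)_\theta=\{f:\mathcal V\to\mathbb C\mid f(T_\gamma v)=e^{i\langle\theta,\gamma\rangle}f(v)\ \text{for all }\gamma\in\mathbb Z^d,\ v\in\mathcal V\}.$$ Then for every $E\in\mathbb R$ the following are equivalent: (i) $N_G$ is continuous at $E$; (ii) $\Delta$ has no eigenfunction of finite support with eigenvalue $E$, i.e. there is no finitely supported $f\neq0$ with $\Delta f=Ef$; (iii) $\Delta$ has no $\ell^2(\mathcal V)$-eigenfunction with eigenvalue $E$, i.e. there is no $f\in\ell^2(\mathcal V)$, $f\neq0$, with $\Delta f=Ef$; (iv) there is $\theta\in\mathbb T^d$ such that $E\notin\sigma(\Delta^\theta)$. -/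

import Mathlib

open scoped ComplexConjugate

noncomputable section

namespace PeriodicGraph

variable {V : Type*}

/-! ### The weighted Hilbert space `ℓ²(V, m)` -/

/-- The one-dimensional Hilbert space `ℂ` with inner product `⟪x, y⟫ = m v * conj x * y`:
the fibre over `v` of the weighted space `ℓ²(V, m)`. -/
def Fiber (m : V → ℝ) (_hm : ∀ v, 0 < m v) (_v : V) : Type := ℂ

section Fiber

variable (m : V → ℝ) (hm : ∀ v, 0 < m v) (v : V)

instance : AddCommGroup (Fiber m hm v) := inferInstanceAs (AddCommGroup ℂ)

instance : Module ℂ (Fiber m hm v) := inferInstanceAs (Module ℂ ℂ)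

instance : FiniteDimensional ℂ (Fiber m hm v) := inferInstanceAs (FiniteDimensional ℂ ℂ)

/-- The underlying complex number of an element of the fibre. -/
def toC : Fiber m hm v ≃ₗ[ℂ] ℂ := LinearEquiv.refl ℂ ℂ

/-- The weighted inner product on the fibre. -/
@[reducible]
def fiberCore : InnerProductSpace.Core ℂ (Fiber m hm v) where
  inner x y := (m v : ℂ) * (conj (toC m hm v x) * toC m hm v y)
  conj_inner_symm x y := by
    simp only [map_mul, Complex.conj_ofReal, Complex.conj_conj]
    rw [mul_comm (toC m hm v y)]
  re_inner_nonneg x := by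
    rw [mul_comm (conj _), Complex.mul_conj, ← Complex.ofReal_mul]
    exact mul_nonneg (hm v).le (Complex.normSq_nonneg _)
  add_left x y z := by
    rw [map_add, map_add]
    ring
  smul_left x y r := by
    rw [map_smul, smul_eq_mul, map_mul]
    ring
  definite x h := by
    have h0 : (m v : ℂ) ≠ 0 := Complex.ofReal_ne_zero.2 (hm v).ne'
    have h' : (m v : ℂ) * (conj (toC m hm v x) * toC m hm v x) = 0 := h
    simpa [h0] using h'

instance : NormedAddCommGroup (Fiber m hm v) := (fiberCore m hm v).toNormedAddCommGroup

instance : InnerProductSpace ℂ (Fiber m hm v) :=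
  InnerProductSpace.ofCore (fiberCore m hm v).toCore

instance : CompleteSpace (Fiber m hm v) := FiniteDimensional.complete ℂ _

variable {m hm v} in
theorem fiber_inner (x y : Fiber m hm v) :
    inner ℂ x y = (m v : ℂ) * (conj (toC m hm v x) * toC m hm v y) := rfl

variable {m hm v} in
theorem fiber_norm_sq (x : Fiber m hm v) : ‖x‖ ^ 2 = m v * ‖toC m hm v x‖ ^ 2 := by
  have h := inner_self_eq_norm_sq (𝕜 := ℂ) x
  rw [← h, fiber_inner, mul_comm (conj _), Complex.mul_conj, ← Complex.ofReal_mul,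
    Complex.normSq_eq_norm_sq]
  rfl

end Fiber

/-- The weighted Hilbert space `ℓ²(V, m)` of functions `f : V → ℂ` with
`∑ m v * |f v|² < ∞`, with inner product `⟪f, g⟫ = ∑ m v * conj (f v) * g v`. -/
abbrev WeightedL2 (m : V → ℝ) (hm : ∀ v, 0 < m v) := lp (Fiber m hm) 2

open Classical in
/-- The canonical orthonormal basis vector `(m v)^(-1/2) δ_v` of `ℓ²(V, m)`. -/
def unitDelta (m : V → ℝ) (hm : ∀ v, 0 < m v) (v : V) : WeightedL2 m hm :=
  lp.single 2 v ((toC m hm v).symm (((Real.sqrt (m v))⁻¹ : ℝ) : ℂ))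

/-- The trace of an operator on `ℓ²(V, m)`, computed in the canonical orthonormal basis. -/
def trace {m : V → ℝ} {hm : ∀ v, 0 < m v} (T : WeightedL2 m hm →L[ℂ] WeightedL2 m hm) : ℂ :=
  ∑' v, inner ℂ (unitDelta m hm v) (T (unitDelta m hm v))

open Classical in
theorem norm_indicator_le {m : V → ℝ} {hm : ∀ v, 0 < m v} (Q : Set V) (f : WeightedL2 m hm)
    (v : V) : ‖(if v ∈ Q then f v else 0 : Fiber m hm v)‖ ≤ ‖f v‖ := by
  split_ifs
  · exact le_rfl
  · simp

open Classical in
/-- Multiplication by the indicator function of a set `Q`, on `ℓ²(V, m)`. -/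
def indicatorMul (m : V → ℝ) (hm : ∀ v, 0 < m v) (Q : Set V) :
    WeightedL2 m hm →L[ℂ] WeightedL2 m hm :=
  LinearMap.mkContinuous
    { toFun := fun f => ⟨fun v => if v ∈ Q then f v else 0,
        (lp.memℓp f).mono' (norm_indicator_le Q f)⟩
      map_add' := by
        intro f g
        ext v
        change (if v ∈ Q then f v + g v else 0 : Fiber m hm v) =
          (if v ∈ Q then f v else 0) + (if v ∈ Q then g v else 0)
        split_ifs <;> simp
      map_smul' := by
        intro c f
        ext v
        change (if v ∈ Q then c • f v else 0 : Fiber m hm v) = c • (if v ∈ Q then f v else 0)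
        split_ifs <;> simp } 1
    (by
      intro f
      rw [one_mul]
      exact lp.norm_mono (by norm_num) (norm_indicator_le Q f))

/-- The spectral projector `χ_{(-∞, E]}(A)` of a bounded self-adjoint operator `A`.
As `(-∞, E]` is the zero set of the continuous function `x ↦ max (x - E) 0`, it is the
orthogonal projection onto the kernel of the positive part `(A - E)₊` of `A - E`. -/
def spectralProjIic {H : Type*} [NormedAddCommGroup H] [InnerProductSpace ℂ H] [CompleteSpace H]
    (A : H →L[ℂ] H) (E : ℝ) : H →L[ℂ] H :=
  ((cfc (fun x : ℝ => max (x - E) 0) A : H →L[ℂ] H).ker).starProjection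

/-! ### The Laplacian -/

/-- The Laplacian `(Δ f)(v) = f v - |v|⁻¹ ∑_{w ∼ v} f w` on arbitrary functions. -/
def lap (G : SimpleGraph V) [G.LocallyFinite] : (V → ℂ) →ₗ[ℂ] (V → ℂ) where
  toFun f v := f v - (G.degree v : ℂ)⁻¹ * ∑ w ∈ G.neighborFinset v, f w
  map_add' f g := by
    ext v
    simp only [Pi.add_apply, Finset.sum_add_distrib]
    ring
  map_smul' c f := by
    ext v
    simp only [Pi.smul_apply, smul_eq_mul, RingHom.id_apply, ← Finset.mul_sum]
    ring

section L2

variable (G : SimpleGraph V) [G.LocallyFinite] (hdeg : ∀ v, 0 < G.degree v)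

/-- The vertex degree as a positive weight. -/
theorem degree_weight_pos {G : SimpleGraph V} [G.LocallyFinite] (hdeg : ∀ v, 0 < G.degree v)
    (v : V) : (0 : ℝ) < (G.degree v : ℝ) := Nat.cast_pos.2 (hdeg v)

/-- The Hilbert space `ℓ²(V, deg)`. -/
abbrev GraphL2 := WeightedL2 (fun v => (G.degree v : ℝ)) (degree_weight_pos hdeg)

/-- The values of an element of `ℓ²(V, deg)`, as a function `V → ℂ`. -/
def toFun (f : GraphL2 G hdeg) : V → ℂ := fun v => toC _ _ v (f v)

/-- The function `v ↦ |v|⁻¹ ∑_{w ∼ v} f w`. -/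
def avgFun (f : GraphL2 G hdeg) (v : V) :
    Fiber (fun v => (G.degree v : ℝ)) (degree_weight_pos hdeg) v :=
  (toC _ _ v).symm ((G.degree v : ℂ)⁻¹ * ∑ w ∈ G.neighborFinset v, toFun G hdeg f w)

theorem avg_sum_le (f : GraphL2 G hdeg) (s : Finset V) :
    ∑ v ∈ s, ‖avgFun G hdeg f v‖ ^ 2 ≤ ‖f‖ ^ 2 := by
  classical
  have h1 : ∀ v, ‖avgFun G hdeg f v‖ ^ 2 ≤
      ∑ w ∈ G.neighborFinset v, ‖toFun G hdeg f w‖ ^ 2 := by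
    intro v
    have hd : (0 : ℝ) < G.degree v := degree_weight_pos hdeg v
    rw [fiber_norm_sq, avgFun, LinearEquiv.apply_symm_apply, norm_mul, norm_inv,
      Complex.norm_natCast, mul_pow]
    have h2 : ‖∑ w ∈ G.neighborFinset v, toFun G hdeg f w‖ ^ 2 ≤
        (G.degree v : ℝ) * ∑ w ∈ G.neighborFinset v, ‖toFun G hdeg f w‖ ^ 2 := by
      refine (pow_le_pow_left₀ (norm_nonneg _) (norm_sum_le _ _) 2).trans ?_
      have := sq_sum_le_card_mul_sum_sq (s := G.neighborFinset v)
        (f := fun w => ‖toFun G hdeg f w‖)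
      rwa [G.card_neighborFinset_eq_degree] at this
    calc (G.degree v : ℝ) * (((G.degree v : ℝ)⁻¹) ^ 2 *
          ‖∑ w ∈ G.neighborFinset v, toFun G hdeg f w‖ ^ 2)
        ≤ (G.degree v : ℝ) * (((G.degree v : ℝ)⁻¹) ^ 2 *
          ((G.degree v : ℝ) * ∑ w ∈ G.neighborFinset v, ‖toFun G hdeg f w‖ ^ 2)) := by
          gcongr
      _ = ∑ w ∈ G.neighborFinset v, ‖toFun G hdeg f w‖ ^ 2 := by
          field_simp
  set U : Finset V := s.biUnion fun v => G.neighborFinset v with hU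
  calc _ ≤ ∑ v ∈ s, ∑ w ∈ G.neighborFinset v, ‖toFun G hdeg f w‖ ^ 2 :=
        Finset.sum_le_sum fun v _ => h1 v
    _ = ∑ w ∈ U, ∑ v ∈ s.filter (fun v => G.Adj v w), ‖toFun G hdeg f w‖ ^ 2 := by
        refine Finset.sum_comm' ?_
        intro v w
        simp only [hU, Finset.mem_biUnion, Finset.mem_filter, SimpleGraph.mem_neighborFinset]
        constructor
        · rintro ⟨a, b⟩
          exact ⟨⟨a, b⟩, v, a, b⟩
        · rintro ⟨⟨a, b⟩, _⟩
          exact ⟨a, b⟩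
    _ ≤ ∑ w ∈ U, ‖f w‖ ^ 2 := by
        refine Finset.sum_le_sum fun w _ => ?_
        rw [Finset.sum_const, nsmul_eq_mul, fiber_norm_sq]
        refine mul_le_mul_of_nonneg_right ?_ (sq_nonneg _)
        rw [← G.card_neighborFinset_eq_degree]
        refine Nat.cast_le.2 (Finset.card_le_card fun v hv => ?_)
        rw [SimpleGraph.mem_neighborFinset]
        exact (Finset.mem_filter.1 hv).2.symm
    _ ≤ ‖f‖ ^ 2 := by
        have := lp.sum_rpow_le_norm_rpow (p := 2) (by norm_num) f U
        simpa using this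

theorem avg_memlp (f : GraphL2 G hdeg) : Memℓp (avgFun G hdeg f) 2 :=
  memℓp_gen' (C := ‖f‖ ^ 2) (fun s => by simpa using avg_sum_le G hdeg f s)

/-- The averaging operator `f ↦ (v ↦ |v|⁻¹ ∑_{w ∼ v} f w)` on `ℓ²(V, deg)`, as a linear map. -/
def avgLin : GraphL2 G hdeg →ₗ[ℂ] GraphL2 G hdeg where
  toFun f := ⟨avgFun G hdeg f, avg_memlp G hdeg f⟩
  map_add' f g := by
    ext v
    change avgFun G hdeg (f + g) v = avgFun G hdeg f v + avgFun G hdeg g v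
    have h : ∀ w, toFun G hdeg (f + g) w = toFun G hdeg f w + toFun G hdeg g w := fun _ => rfl
    simp only [avgFun, h, Finset.sum_add_distrib, mul_add, map_add]
  map_smul' c f := by
    ext v
    change avgFun G hdeg (c • f) v = c • avgFun G hdeg f v
    have h : ∀ w, toFun G hdeg (c • f) w = c * toFun G hdeg f w := fun _ => rfl
    simp only [avgFun, h, ← Finset.mul_sum, ← map_smul, smul_eq_mul]
    rw [mul_left_comm]

/-- The averaging operator as a bounded operator on `ℓ²(V, deg)`. -/
def avgL2 : GraphL2 G hdeg →L[ℂ] GraphL2 G hdeg :=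
  (avgLin G hdeg).mkContinuous 1 (by
    intro f
    rw [one_mul]
    refine lp.norm_le_of_forall_sum_le (p := 2) (by norm_num) (norm_nonneg f) fun s => ?_
    have h := avg_sum_le G hdeg f s
    rw [ENNReal.toReal_ofNat, Real.rpow_ofNat]
    simp only [Real.rpow_ofNat]
    exact h)

/-- The Laplacian as a bounded operator on `ℓ²(V, deg)`. -/
def lapL2 : GraphL2 G hdeg →L[ℂ] GraphL2 G hdeg :=
  ContinuousLinearMap.id ℂ _ - avgL2 G hdeg

/-- `lapL2` acts by the formula of the Laplacian. -/
theorem toFun_lapL2 (f : GraphL2 G hdeg) :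
    toFun G hdeg (lapL2 G hdeg f) = lap G (toFun G hdeg f) := rfl

/-- The Laplacian on `ℓ²(V, deg)` is self-adjoint. -/
theorem isSelfAdjoint_lapL2 : IsSelfAdjoint (lapL2 G hdeg) := by
  classical
  refine IsSelfAdjoint.sub (IsSelfAdjoint.one _) ?_
  rw [ContinuousLinearMap.isSelfAdjoint_iff_isSymmetric]
  have hne : ∀ u, (G.degree u : ℂ) ≠ 0 := fun u => Nat.cast_ne_zero.2 (hdeg u).ne'
  have key : ∀ (f : GraphL2 G hdeg) (v : V)
      (c : Fiber (fun v => (G.degree v : ℝ)) (degree_weight_pos hdeg) v),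
      inner ℂ (avgL2 G hdeg f) (lp.single 2 v c) = inner ℂ f (avgL2 G hdeg (lp.single 2 v c)) := by
    intro f v c
    have h3 : ∀ w, toFun G hdeg (lp.single 2 v c) w = if w = v then toC _ _ v c else 0 := by
      intro w
      by_cases h : w = v
      · subst h
        rw [if_pos rfl, toFun, lp.single_apply_self]
      · rw [if_neg h, toFun, lp.single_apply_ne _ _ _ h, map_zero]
    have h1 : inner ℂ (avgL2 G hdeg f) (lp.single 2 v c) =
        inner ℂ (avgFun G hdeg f v) c := lp.inner_single_right v c _
    have h2 : ∀ u, inner ℂ (f u) (avgL2 G hdeg (lp.single 2 v c) u) =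
        if u ∈ G.neighborFinset v then conj (toFun G hdeg f u) * toC _ _ v c else 0 := by
      intro u
      change inner ℂ (f u) (avgFun G hdeg (lp.single 2 v c) u) = _
      rw [fiber_inner, avgFun, LinearEquiv.apply_symm_apply]
      simp only [h3, Finset.sum_ite_eq', SimpleGraph.mem_neighborFinset, G.adj_comm u v,
        Complex.ofReal_natCast]
      have := hne u
      split_ifs
      · rw [toFun]
        field_simp
      · simp
    rw [h1, lp.inner_eq_tsum]
    simp_rw [h2]
    rw [tsum_eq_sum (s := G.neighborFinset v) (fun u hu => if_neg hu),
      Finset.sum_congr rfl fun u hu => if_pos hu, ← Finset.sum_mul, fiber_inner, avgFun,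
      LinearEquiv.apply_symm_apply, map_mul, map_sum, map_inv₀, map_natCast,
      Complex.ofReal_natCast]
    have := hne v
    field_simp
  intro f g
  have hg := lp.hasSum_single (p := 2) (by norm_num) g
  have e1 := hg.mapL (innerSL ℂ (avgL2 G hdeg f))
  have e2 := hg.mapL ((innerSL ℂ f).comp (avgL2 G hdeg))
  have e3 : (fun v => innerSL ℂ (avgL2 G hdeg f) (lp.single 2 v (g v))) =
      fun v => ((innerSL ℂ f).comp (avgL2 G hdeg)) (lp.single 2 v (g v)) :=
    funext fun v => key f v (g v)
  rw [e3] at e1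
  exact e1.unique e2

/-- The integrated density of states
`N_G(E) = |Q|⁻¹ Tr (χ_Q χ_{(-∞, E]}(Δ))` relative to a finite fundamental domain `Q`. -/
def IDS (Q : Finset V) (E : ℝ) : ℝ :=
  (Q.card : ℝ)⁻¹ *
    (trace ((indicatorMul _ (degree_weight_pos hdeg) (Q : Set V)).comp
      (spectralProjIic (lapL2 G hdeg) E))).re

end L2

/-! ### Periodicity and the Floquet operators -/

/-- `ℤ^d` acts freely on the vertices, by automorphisms of the graph. -/
structure IsPeriodic (d : ℕ) [AddAction (Fin d → ℤ) V] (G : SimpleGraph V) : Prop where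
  adj_iff : ∀ (γ : Fin d → ℤ) (v w : V), G.Adj (γ +ᵥ v) (γ +ᵥ w) ↔ G.Adj v w
  free : ∀ (γ : Fin d → ℤ) (v : V), γ +ᵥ v = v → γ = 0

/-- `Q` contains exactly one vertex of every orbit of the action of `ℤ^d`. -/
def IsFundamentalDomain (d : ℕ) [AddAction (Fin d → ℤ) V] (Q : Finset V) : Prop :=
  ∀ v : V, ∃! q : V, q ∈ Q ∧ ∃ γ : Fin d → ℤ, γ +ᵥ q = v

/-- The torus `ℝ^d / (2πℤ)^d`. -/
abbrev Torus (d : ℕ) : Type := Fin d → Real.Angle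

/-- The character `e^{i⟨θ, γ⟩}`. -/
def character {d : ℕ} (θ : Torus d) (γ : Fin d → ℤ) : ℂ :=
  ((∑ j, γ j • θ j : Real.Angle).toCircle : ℂ)

/-- The space `ℓ²(V)_θ` of `θ`-quasiperiodic functions. -/
def quasiperiodic (V : Type*) {d : ℕ} [AddAction (Fin d → ℤ) V] (θ : Torus d) :
    Submodule ℂ (V → ℂ) where
  carrier := {f | ∀ (γ : Fin d → ℤ) (v : V), f (γ +ᵥ v) = character θ γ * f v}
  add_mem' := by
    intro f g hf hg γ v
    rw [Pi.add_apply, Pi.add_apply, hf, hg, mul_add]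
  zero_mem' := by
    intro γ v
    simp
  smul_mem' := by
    intro c f hf γ v
    rw [Pi.smul_apply, Pi.smul_apply, hf, smul_eq_mul, smul_eq_mul]
    ring

theorem IsPeriodic.neighborFinset_vadd {d : ℕ} [AddAction (Fin d → ℤ) V] {G : SimpleGraph V}
    [G.LocallyFinite] (hG : IsPeriodic d G) (γ : Fin d → ℤ) (v : V) :
    G.neighborFinset (γ +ᵥ v) =
      (G.neighborFinset v).map (AddAction.toPerm γ).toEmbedding := by
  ext w
  simp only [SimpleGraph.mem_neighborFinset, Finset.mem_map, Equiv.coe_toEmbedding,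
    AddAction.toPerm_apply]
  constructor
  · intro h
    refine ⟨-γ +ᵥ w, ?_, vadd_neg_vadd γ w⟩
    rw [← hG.adj_iff γ, vadd_neg_vadd]
    exact h
  · rintro ⟨u, hu, rfl⟩
    exact (hG.adj_iff γ v u).2 hu

theorem IsPeriodic.lap_mem_quasiperiodic {d : ℕ} [AddAction (Fin d → ℤ) V] {G : SimpleGraph V}
    [G.LocallyFinite] (hG : IsPeriodic d G) (θ : Torus d) :
    ∀ f ∈ quasiperiodic V θ, lap G f ∈ quasiperiodic V θ := by
  intro f hf γ v
  have hf' : ∀ (γ : Fin d → ℤ) (v : V), f (γ +ᵥ v) = character θ γ * f v := hf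
  change f (γ +ᵥ v) - (G.degree (γ +ᵥ v) : ℂ)⁻¹ * ∑ w ∈ G.neighborFinset (γ +ᵥ v), f w =
    character θ γ * (f v - (G.degree v : ℂ)⁻¹ * ∑ w ∈ G.neighborFinset v, f w)
  rw [← G.card_neighborFinset_eq_degree, ← G.card_neighborFinset_eq_degree,
    hG.neighborFinset_vadd, Finset.card_map, Finset.sum_map, hf']
  simp only [Equiv.coe_toEmbedding, AddAction.toPerm_apply, hf', ← Finset.mul_sum]
  ring

/-- The `θ`-pseudoperiodic Laplacian `Δ^θ`: the restriction of the Laplacian to the space of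
`θ`-quasiperiodic functions. -/
def floquetLap {d : ℕ} [AddAction (Fin d → ℤ) V] {G : SimpleGraph V} [G.LocallyFinite]
    (hG : IsPeriodic d G) (θ : Torus d) : Module.End ℂ (quasiperiodic V θ) :=
  (lap G).restrict (hG.lap_mem_quasiperiodic θ)

end PeriodicGraph

end

/-! The choice of `Q` identifies the vertices with `ℤ^d × Q`. On finitely supported functions `Δ -
E` then becomes a `Q × Q` matrix over the Laurent polynomial ring `ℂ[ℤ^d]`. This ring is a domain,
so a finitely supported eigenfunction exists iff the determinant is zero
(`exists_finite_support_iff_det_eq_zero`). Evaluated at `θ`, the same matrix represents `Δ^θ - E`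
(`mem_spectrum_floquetLap_iff`), and a Laurent polynomial vanishing on the whole torus is zero. This
gives (ii) ⇔ (iv).

Finitely supported functions are square-summable, so (iii) implies (ii). The converse is a Følner
argument. Without finitely supported eigenfunctions, an `ℓ²`-eigenfunction that vanishes on a thick
boundary shell of a box vanishes on the box, since otherwise its truncation would be one
(`lap_truncate`). Hence the trace over the box of the eigenprojection is at most the number of shell
vertices. The diagonal of the projection is periodic, so each of its entries is bounded by a
multiple of the relative size of the shell, which tends to zero as the box grows.

For (i) ⇔ (iii), `N_G` is an average over `Q` of `‖P_E e_q‖²`, where `e_q` is the normalised delta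
at `q` and `P_E` the spectral projector. The `P_E` are strongly right continuous, and strongly left
continuous if `ker (Δ - E)` is trivial. Otherwise `N_G` jumps at least by the average of the
diagonal of the eigenprojection, which is positive by periodicity. -/

namespace PeriodicGraph

/-! ### Orbit coordinates -/

section Coordinates

variable {V : Type*} {d : ℕ} [AddAction (Fin d → ℤ) V] {Q : Finset V}

/-- The representative in `Q` of the orbit of `v`. -/
noncomputable def orbitRep (hQ : IsFundamentalDomain d Q) (v : V) : Q :=
  ⟨(hQ v).choose, (hQ v).choose_spec.1.1⟩

/-- The translation that takes the orbit representative of `v` to `v`. -/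
noncomputable def orbitShift (hQ : IsFundamentalDomain d Q) (v : V) : Fin d → ℤ :=
  (hQ v).choose_spec.1.2.choose

theorem orbitShift_vadd_orbitRep (hQ : IsFundamentalDomain d Q) (v : V) :
    orbitShift hQ v +ᵥ (orbitRep hQ v : V) = v :=
  (hQ v).choose_spec.1.2.choose_spec

theorem orbitRep_vadd (hQ : IsFundamentalDomain d Q) (γ : Fin d → ℤ) (v : V) :
    orbitRep hQ (γ +ᵥ v) = orbitRep hQ v := by
  refine Subtype.ext ((hQ (γ +ᵥ v)).unique ⟨(orbitRep hQ (γ +ᵥ v)).2, orbitShift hQ (γ +ᵥ v),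
    orbitShift_vadd_orbitRep hQ _⟩ ⟨(orbitRep hQ v).2, γ + orbitShift hQ v, ?_⟩)
  rw [add_vadd, orbitShift_vadd_orbitRep]

theorem orbitRep_coe (hQ : IsFundamentalDomain d Q) (q : Q) : orbitRep hQ (q : V) = q :=
  Subtype.ext ((hQ q).unique ⟨(orbitRep hQ (q : V)).2, orbitShift hQ (q : V),
    orbitShift_vadd_orbitRep hQ _⟩ ⟨q.2, 0, zero_vadd _ _⟩)

variable {G : SimpleGraph V}

theorem IsPeriodic.vadd_right_cancel (hG : IsPeriodic d G) {γ γ' : Fin d → ℤ} {v : V}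
    (h : γ +ᵥ v = γ' +ᵥ v) : γ = γ' := by
  have h1 : (-γ' + γ) +ᵥ v = v := by rw [add_vadd, h, neg_vadd_vadd]
  exact (neg_add_eq_zero.1 (hG.free _ _ h1)).symm

theorem IsPeriodic.orbitShift_vadd (hG : IsPeriodic d G) (hQ : IsFundamentalDomain d Q)
    (γ : Fin d → ℤ) (v : V) : orbitShift hQ (γ +ᵥ v) = γ + orbitShift hQ v := by
  refine hG.vadd_right_cancel (v := (orbitRep hQ v : V)) ?_
  rw [add_vadd, orbitShift_vadd_orbitRep]
  conv_lhs => rw [← orbitRep_vadd hQ γ v]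
  exact orbitShift_vadd_orbitRep hQ _

theorem IsPeriodic.orbitShift_coe (hG : IsPeriodic d G) (hQ : IsFundamentalDomain d Q) (q : Q) :
    orbitShift hQ (q : V) = 0 := by
  refine hG.free _ (q : V) ?_
  conv_lhs => rw [← orbitRep_coe hQ q, orbitRep_coe hQ q]
  conv_rhs => rw [← orbitShift_vadd_orbitRep hQ (q : V), orbitRep_coe hQ q]

/-- The vertices of a periodic graph are parametrised by `ℤ^d × Q`. -/
noncomputable def IsPeriodic.vertexEquiv (hG : IsPeriodic d G) (hQ : IsFundamentalDomain d Q) :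
    (Fin d → ℤ) × Q ≃ V where
  toFun p := p.1 +ᵥ (p.2 : V)
  invFun v := (orbitShift hQ v, orbitRep hQ v)
  left_inv p := by
    simp only [hG.orbitShift_vadd, hG.orbitShift_coe, orbitRep_vadd, orbitRep_coe, add_zero]
  right_inv v := orbitShift_vadd_orbitRep hQ v

theorem IsPeriodic.lap_vadd [G.LocallyFinite] (hG : IsPeriodic d G) (γ : Fin d → ℤ) (f : V → ℂ)
    (v : V) : lap G f (γ +ᵥ v) =
      f (γ +ᵥ v) - (G.degree v : ℂ)⁻¹ * ∑ w ∈ G.neighborFinset v, f (γ +ᵥ w) := by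
  change f (γ +ᵥ v) - (G.degree (γ +ᵥ v) : ℂ)⁻¹ * ∑ w ∈ G.neighborFinset (γ +ᵥ v), f w = _
  rw [← G.card_neighborFinset_eq_degree, ← G.card_neighborFinset_eq_degree,
    hG.neighborFinset_vadd, Finset.card_map, Finset.sum_map]
  rfl

theorem IsPeriodic.lap_comp_vadd [G.LocallyFinite] (hG : IsPeriodic d G) (γ : Fin d → ℤ)
    (f : V → ℂ) : lap G (fun v => f (γ +ᵥ v)) = fun v => lap G f (γ +ᵥ v) :=
  funext fun v => (hG.lap_vadd γ f v).symm

end Coordinates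

/-! ### Laurent polynomials on the torus -/

section Laurent

variable {d : ℕ}

theorem character_zero (θ : Torus d) : character θ 0 = 1 := by
  simp [character]

theorem character_add (θ : Torus d) (γ γ' : Fin d → ℤ) :
    character θ (γ + γ') = character θ γ * character θ γ' := by
  simp only [character, Pi.add_apply, add_smul, Finset.sum_add_distrib, Real.Angle.toCircle_add,
    Circle.coe_mul]

/-- The character `γ ↦ e^{i⟨θ, γ⟩}` of `ℤ^d`. -/
noncomputable def characterHom (θ : Torus d) : Multiplicative (Fin d → ℤ) →* ℂ where
  toFun γ := character θ γ.toAdd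
  map_one' := character_zero θ
  map_mul' γ γ' := character_add θ γ.toAdd γ'.toAdd

/-- The character `θ ↦ e^{i⟨θ, γ⟩}` of the torus. -/
noncomputable def torusCharacter (γ : Fin d → ℤ) : Multiplicative (Torus d) →* ℂ where
  toFun θ := character θ.toAdd γ
  map_one' := by simp [character]
  map_mul' θ θ' := by
    simp only [character, toAdd_mul, Pi.add_apply, smul_add, Finset.sum_add_distrib,
      Real.Angle.toCircle_add, Circle.coe_mul]

theorem torusCharacter_injective :
    Function.Injective (torusCharacter : (Fin d → ℤ) → Multiplicative (Torus d) →* ℂ) := by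
  intro γ γ' h
  funext j
  by_contra hne
  have hne' : ((γ j - γ' j : ℤ) : ℝ) ≠ 0 := Int.cast_ne_zero.2 (sub_ne_zero.2 hne)
  -- With this angle the two characters differ at `θ` by the factor `e^{iπ} = -1`.
  set θ : Torus d := Pi.single j ((Real.pi / ((γ j - γ' j : ℤ) : ℝ) : ℝ) : Real.Angle) with hθ
  have hc : ∀ δ : Fin d → ℤ, ∑ i, δ i • θ i = δ j • θ j := fun δ =>
    Finset.sum_eq_single j (fun i _ hi => by rw [hθ, Pi.single_eq_of_ne hi, smul_zero])
      (fun hj => absurd (Finset.mem_univ j) hj)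
  have h1 : character θ γ = character θ γ' := DFunLike.congr_fun h (Multiplicative.ofAdd θ)
  simp only [character, hc, Circle.coe_inj] at h1
  have h3 : γ j • θ j = γ' j • θ j := by
    rw [← Real.Angle.arg_toCircle (γ j • θ j), h1, Real.Angle.arg_toCircle]
  rw [← sub_eq_zero, ← sub_smul, hθ, Pi.single_eq_same, ← Real.Angle.coe_zsmul, zsmul_eq_mul,
    mul_div_cancel₀ _ hne'] at h3
  exact Real.Angle.pi_ne_zero h3

/-- Evaluation of a Laurent polynomial at a point of the torus. -/
noncomputable def torusEval (θ : Torus d) : AddMonoidAlgebra ℂ (Fin d → ℤ) →ₐ[ℂ] ℂ :=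
  AddMonoidAlgebra.lift ℂ ℂ (Fin d → ℤ) (characterHom θ)

theorem torusEval_single (θ : Torus d) (γ : Fin d → ℤ) (c : ℂ) :
    torusEval θ (AddMonoidAlgebra.single γ c) = c * character θ γ :=
  AddMonoidAlgebra.lift_single _ _ _

/-- A Laurent polynomial that vanishes on the torus is zero. -/
theorem eq_zero_of_torusEval_eq_zero (p : AddMonoidAlgebra ℂ (Fin d → ℤ))
    (h : ∀ θ, torusEval θ p = 0) : p = 0 := by
  -- Dedekind's independence of characters: the values of `p` on the torus form a linear combination
  -- of distinct characters of the torus, with the coefficients of `p`.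
  have hli : LinearIndependent ℂ
      (fun γ : Fin d → ℤ => ((torusCharacter γ : Multiplicative (Torus d) →* ℂ) :
        Multiplicative (Torus d) → ℂ)) :=
    (linearIndependent_monoidHom (Multiplicative (Torus d)) ℂ).comp _ torusCharacter_injective
  rw [← AddMonoidAlgebra.coeff_eq_zero]
  refine (linearIndependent_iff.1 hli) p.coeff ?_
  funext θ
  have := h θ.toAdd
  rw [torusEval, AddMonoidAlgebra.lift_apply] at this
  rw [Finsupp.linearCombination_apply, Finsupp.sum, Finset.sum_apply]
  exact this

end Laurent

/-! ### The Floquet matrix -/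

section Floquet

variable {V : Type*} {d : ℕ} [AddAction (Fin d → ℤ) V] {G : SimpleGraph V} {Q : Finset V}

/-- The quasiperiodic extension of a function on the fundamental domain. -/
noncomputable def quasiperiodicExtend (hQ : IsFundamentalDomain d Q) (θ : Torus d) (x : Q → ℂ) :
    V → ℂ := fun v => character θ (orbitShift hQ v) * x (orbitRep hQ v)

theorem quasiperiodicExtend_mem (hG : IsPeriodic d G) (hQ : IsFundamentalDomain d Q) (θ : Torus d)
    (x : Q → ℂ) : quasiperiodicExtend hQ θ x ∈ quasiperiodic V θ := by
  intro γ v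
  rw [quasiperiodicExtend, quasiperiodicExtend, hG.orbitShift_vadd, orbitRep_vadd, character_add,
    mul_assoc]

theorem quasiperiodicExtend_coe (hG : IsPeriodic d G) (hQ : IsFundamentalDomain d Q) (θ : Torus d)
    (x : Q → ℂ) (q : Q) : quasiperiodicExtend hQ θ x q = x q := by
  rw [quasiperiodicExtend, hG.orbitShift_coe, orbitRep_coe, character_zero, one_mul]

theorem quasiperiodic_ext (hQ : IsFundamentalDomain d Q) {θ : Torus d} {f g : V → ℂ}
    (hf : f ∈ quasiperiodic V θ) (hg : g ∈ quasiperiodic V θ) (h : ∀ q ∈ Q, f q = g q) : f = g := by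
  funext v
  rw [← orbitShift_vadd_orbitRep hQ v, hf, hg, h _ (orbitRep hQ v).2]

theorem finiteDimensional_quasiperiodic (hQ : IsFundamentalDomain d Q) (θ : Torus d) :
    FiniteDimensional ℂ (quasiperiodic V θ) := by
  let r : quasiperiodic V θ →ₗ[ℂ] (Q → ℂ) :=
    (LinearMap.funLeft ℂ ℂ (fun q : Q => (q : V))).comp (quasiperiodic V θ).subtype
  refine Module.Finite.of_injective r fun f g h => Subtype.ext ?_
  exact quasiperiodic_ext hQ f.2 g.2 fun q hq => congrFun h ⟨q, hq⟩

variable [G.LocallyFinite]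

open Classical in
/-- The matrix of Laurent polynomials that represents `Δ - E`. -/
noncomputable def laurentMatrix (G : SimpleGraph V) [G.LocallyFinite]
    (hQ : IsFundamentalDomain d Q) (E : ℂ) : Matrix Q Q (AddMonoidAlgebra ℂ (Fin d → ℤ)) :=
  fun q q' => (if q = q' then AddMonoidAlgebra.single 0 (1 - E) else 0) -
    ∑ w ∈ G.neighborFinset (q : V), if orbitRep hQ w = q' then
      AddMonoidAlgebra.single (orbitShift hQ w) (G.degree (q : V) : ℂ)⁻¹ else 0

/-- One formula for two uses: `φ` is the identity for finitely supported functions, and evaluation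
at `θ` for quasiperiodic ones. -/
theorem map_laurentMatrix_mulVec {R : Type*} [CommRing R] (hQ : IsFundamentalDomain d Q) (E : ℂ)
    (φ : AddMonoidAlgebra ℂ (Fin d → ℤ) →+* R) (x : Q → R) (q : Q) :
    (((laurentMatrix G hQ E).map φ).mulVec x) q =
      φ (AddMonoidAlgebra.single 0 (1 - E)) * x q - ∑ w ∈ G.neighborFinset (q : V),
        φ (AddMonoidAlgebra.single (orbitShift hQ w) (G.degree (q : V) : ℂ)⁻¹) *
          x (orbitRep hQ w) := by
  classical
  simp only [Matrix.mulVec, dotProduct, Matrix.map_apply, laurentMatrix, map_sub, map_sum, sub_mul,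
    Finset.sum_sub_distrib, apply_ite φ, map_zero, ite_mul, zero_mul, Finset.sum_mul]
  rw [Finset.sum_comm (s := Finset.univ)]
  simp

/-- Multiplication by the monomial of exponent `δ` moves the coefficient at `-(γ + δ)` to `-γ`. The
sign in `hF` therefore lets the monomial act as the translation `f (γ +ᵥ ·) ↦ f ((γ + δ) +ᵥ ·)`,
while on the torus it evaluates to `e^{i⟨θ, δ⟩}`. This is why a single matrix serves both pictures.
-/
theorem coeff_laurentMatrix_mulVec (hG : IsPeriodic d G) (hQ : IsFundamentalDomain d Q) (E : ℂ)
    (f : V → ℂ) (F : Q → AddMonoidAlgebra ℂ (Fin d → ℤ))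
    (hF : ∀ (q : Q) (γ : Fin d → ℤ), (F q).coeff (-γ) = f (γ +ᵥ (q : V))) (q : Q)
    (γ : Fin d → ℤ) :
    (((laurentMatrix G hQ E).mulVec F) q).coeff (-γ) =
      lap G f (γ +ᵥ (q : V)) - E * f (γ +ᵥ (q : V)) := by
  have h := map_laurentMatrix_mulVec (G := G) hQ E (RingHom.id _) F q
  have hid : (laurentMatrix G hQ E).map (RingHom.id (AddMonoidAlgebra ℂ (Fin d → ℤ))) =
    laurentMatrix G hQ E := by ext; rfl
  rw [hid] at h
  have h1 : ∀ w : V, (F (orbitRep hQ w)).coeff (-orbitShift hQ w + -γ) = f (γ +ᵥ w) := by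
    intro w
    rw [← neg_add_rev, hF, add_vadd, orbitShift_vadd_orbitRep]
  rw [h, hG.lap_vadd]
  simp only [RingHom.id_apply, AddMonoidAlgebra.coeff_sub, AddMonoidAlgebra.coeff_sum,
    Finsupp.sub_apply, Finsupp.finsetSum_apply, AddMonoidAlgebra.coeff_single_mul_apply, neg_zero,
    zero_add, h1, hF, ← Finset.mul_sum]
  ring

/-- `Δ` has a finitely supported eigenfunction at `E` iff the Laurent matrix is singular. -/
theorem exists_finite_support_iff_det_eq_zero [DecidableEq Q] (hG : IsPeriodic d G)
    (hQ : IsFundamentalDomain d Q) (E : ℂ) :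
    (∃ f : V → ℂ, f ≠ 0 ∧ (Function.support f).Finite ∧ lap G f = E • f) ↔
      (laurentMatrix G hQ E).det = 0 := by
  -- Over a domain, a singular matrix has a nonzero kernel vector with entries in the ring itself:
  -- denominators can be cleared.
  rw [← Matrix.exists_mulVec_eq_zero_iff]
  constructor
  · rintro ⟨f, hf0, hfin, hf⟩
    have hinj : ∀ q : Q, Function.Injective fun γ : Fin d → ℤ => -γ +ᵥ (q : V) := fun q γ γ' h =>
      neg_injective (hG.vadd_right_cancel h)
    set F : Q → AddMonoidAlgebra ℂ (Fin d → ℤ) := fun q => AddMonoidAlgebra.ofCoeff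
      (Finsupp.ofSupportFinite (fun γ => f (-γ +ᵥ (q : V)))
        (hfin.preimage (hinj q).injOn)) with hFdef
    have hF : ∀ (q : Q) (γ : Fin d → ℤ), (F q).coeff (-γ) = f (γ +ᵥ (q : V)) := by
      intro q γ
      rw [hFdef]
      change f (- -γ +ᵥ (q : V)) = _
      rw [neg_neg]
    refine ⟨F, fun h0 => hf0 (funext fun v => ?_), funext fun q => ?_⟩
    · rw [← orbitShift_vadd_orbitRep hQ v, ← hF, h0]
      rfl
    · ext γ
      rw [← neg_neg γ, coeff_laurentMatrix_mulVec hG hQ E f F hF, hf]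
      simp
  · rintro ⟨F, hF0, hF⟩
    set f : V → ℂ := fun v => (F (orbitRep hQ v)).coeff (-orbitShift hQ v) with hfdef
    have hfF : ∀ (q : Q) (γ : Fin d → ℤ), (F q).coeff (-γ) = f (γ +ᵥ (q : V)) := by
      intro q γ
      simp only [hfdef, orbitRep_vadd, orbitRep_coe, hG.orbitShift_vadd, hG.orbitShift_coe,
        add_zero]
    refine ⟨f, fun h0 => hF0 (funext fun q => ?_), ?_, funext fun v => ?_⟩
    · ext γ
      rw [← neg_neg γ, hfF, h0]
      simp
    · refine (Set.finite_iUnion fun q : Q => ((F q).coeff.support.finite_toSet.image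
        fun γ : Fin d → ℤ => -γ +ᵥ (q : V))).subset fun v hv => ?_
      refine Set.mem_iUnion.2 ⟨orbitRep hQ v, -orbitShift hQ v, ?_, ?_⟩
      · exact Finsupp.mem_support_iff.2 hv
      · simp only [neg_neg]
        exact orbitShift_vadd_orbitRep hQ v
    · have h := coeff_laurentMatrix_mulVec hG hQ E f F hfF (orbitRep hQ v) (orbitShift hQ v)
      rw [hF, orbitShift_vadd_orbitRep] at h
      exact sub_eq_zero.1 h.symm

theorem torusEval_laurentMatrix_mulVec (hQ : IsFundamentalDomain d Q) (E : ℂ)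
    (θ : Torus d) (f : V → ℂ) (hf : f ∈ quasiperiodic V θ) (q : Q) :
    (((laurentMatrix G hQ E).map (torusEval θ : _ →+* ℂ)).mulVec fun q => f q) q =
      lap G f q - E * f q := by
  have hf' : ∀ (γ : Fin d → ℤ) (v : V), f (γ +ᵥ v) = character θ γ * f v := hf
  have h1 : ∀ w : V, character θ (orbitShift hQ w) * f (orbitRep hQ w : V) = f w := by
    intro w
    rw [← hf', orbitShift_vadd_orbitRep]
  rw [map_laurentMatrix_mulVec]
  simp only [RingHom.coe_coe, torusEval_single, character_zero, mul_assoc, h1, ← Finset.mul_sum]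
  change _ = f q - _ - E * f q
  ring

/-- `E ∈ σ(Δ^θ)` iff the determinant of the Laurent matrix vanishes at `θ`. -/
theorem mem_spectrum_floquetLap_iff [DecidableEq Q] (hG : IsPeriodic d G)
    (hQ : IsFundamentalDomain d Q) (E : ℂ) (θ : Torus d) :
    E ∈ spectrum ℂ (floquetLap hG θ) ↔ torusEval θ (laurentMatrix G hQ E).det = 0 := by
  have := finiteDimensional_quasiperiodic hQ θ
  have hdet : torusEval θ (laurentMatrix G hQ E).det =
      ((laurentMatrix G hQ E).map (torusEval θ : _ →+* ℂ)).det :=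
    RingHom.map_det (torusEval θ : AddMonoidAlgebra ℂ (Fin d → ℤ) →+* ℂ) _
  rw [hdet, ← Matrix.exists_mulVec_eq_zero_iff, ← Module.End.hasEigenvalue_iff_mem_spectrum]
  constructor
  · intro h
    obtain ⟨f, hf⟩ := h.exists_hasEigenvector
    have hf1 : lap G f.1 = E • f.1 := congrArg Subtype.val hf.apply_eq_smul
    refine ⟨fun q => f.1 q, fun h0 => hf.2 (Subtype.ext ?_), funext fun q => ?_⟩
    · exact quasiperiodic_ext hQ f.2 (Submodule.zero_mem _) fun q hq => congrFun h0 ⟨q, hq⟩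
    · rw [torusEval_laurentMatrix_mulVec hQ E θ f.1 f.2, hf1]
      simp
  · rintro ⟨x, hx0, hx⟩
    have hmem := quasiperiodicExtend_mem hG hQ θ x
    have hres : (fun q : Q => quasiperiodicExtend hQ θ x q) = x :=
      funext fun q => quasiperiodicExtend_coe hG hQ θ x q
    refine Module.End.hasEigenvalue_of_hasEigenvector (x := ⟨_, hmem⟩)
      ⟨Module.End.mem_eigenspace_iff.2 (Subtype.ext ?_), fun h0 => hx0 ?_⟩
    · change lap G (quasiperiodicExtend hQ θ x) = E • quasiperiodicExtend hQ θ x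
      refine quasiperiodic_ext hQ (hG.lap_mem_quasiperiodic θ _ hmem)
        (Submodule.smul_mem _ _ hmem) fun q hq => ?_
      have h := torusEval_laurentMatrix_mulVec (G := G) hQ E θ _ hmem ⟨q, hq⟩
      rw [hres, hx] at h
      exact sub_eq_zero.1 h.symm
    · have h1 : quasiperiodicExtend hQ θ x = 0 := congrArg Subtype.val h0
      rw [← hres, h1]
      rfl

/-- There is no finitely supported eigenfunction at `E` iff `E` is outside the spectrum of some
Floquet operator. -/
theorem not_exists_finite_support_iff (hG : IsPeriodic d G) (hQ : IsFundamentalDomain d Q) (E : ℂ) :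
    (¬ ∃ f : V → ℂ, f ≠ 0 ∧ (Function.support f).Finite ∧ lap G f = E • f) ↔
      ∃ θ : Torus d, E ∉ spectrum ℂ (floquetLap hG θ) := by
  classical
  rw [exists_finite_support_iff_det_eq_zero hG hQ, not_iff_comm, not_exists_not]
  simp only [mem_spectrum_floquetLap_iff hG hQ]
  exact ⟨eq_zero_of_torusEval_eq_zero _, fun h θ => by rw [h, map_zero]⟩

end Floquet

end PeriodicGraph

/-- Trace-rank inequality: if every vector of `K` orthogonal to `e b` for all `b ∈ B` is orthogonal
to `e v` for all `v ∈ s`, then `∑ v ∈ s, ⟪e v, P (e v)⟫ ≤ #B`, where `P` is the orthogonal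
projection onto `K`. -/
theorem Orthonormal.sum_norm_starProjection_sq_le_card {H ι : Type*} [NormedAddCommGroup H]
    [InnerProductSpace ℂ H] {e : ι → H} (he : Orthonormal ℂ e) (K : Submodule ℂ H)
    [K.HasOrthogonalProjection] (s B : Finset ι)
    (h : ∀ f ∈ K, (∀ b ∈ B, inner ℂ (e b) f = 0) → ∀ v ∈ s, inner ℂ (e v) f = 0) :
    ∑ v ∈ s, ‖K.starProjection (e v)‖ ^ 2 ≤ B.card := by
  classical
  set W : Submodule ℂ H := Submodule.span ℂ (B.image fun b => K.starProjection (e b) : Finset H)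
    with hW
  have hWK : W ≤ K := Submodule.span_le.2 fun x hx => by
    obtain ⟨b, -, rfl⟩ := Finset.mem_image.1 (Finset.mem_coe.1 hx)
    exact K.starProjection_apply_mem _
  have hfin : FiniteDimensional ℂ W := FiniteDimensional.span_finset ℂ _
  have hmove : ∀ v, ∀ f ∈ K, inner ℂ (K.starProjection (e v)) f = inner ℂ (e v) f := fun v f hf => by
    rw [Submodule.inner_starProjection_left_eq_right, Submodule.starProjection_eq_self_iff.2 hf]
  -- The part `g` of `P (e v)` orthogonal to `W` lies in `K` and is orthogonal to every `e b`. By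
  -- `h` it is orthogonal to `e v`, which forces `g = 0`.
  have hmem : ∀ v ∈ s, K.starProjection (e v) ∈ W := by
    intro v hv
    set g := K.starProjection (e v) - W.starProjection (K.starProjection (e v)) with hg
    have hgW : g ∈ Wᗮ := W.sub_starProjection_mem_orthogonal _
    have hgK : g ∈ K := K.sub_mem (K.starProjection_apply_mem _)
      (hWK (W.starProjection_apply_mem _))
    have h1 : inner ℂ (e v) g = 0 := by
      refine h g hgK (fun b hb => ?_) v hv
      rw [← hmove b g hgK]
      exact hgW _ (Submodule.subset_span (Finset.mem_coe.2 (Finset.mem_image_of_mem _ hb)))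
    have h2 : inner ℂ g g = 0 := by
      conv_lhs => rw [hg, inner_sub_left, ← hg]
      rw [hmove v g hgK, h1, hgW _ (W.starProjection_apply_mem _), sub_zero]
    rw [inner_self_eq_zero, hg, sub_eq_zero] at h2
    rw [h2]
    exact W.starProjection_apply_mem _
  set u := stdOrthonormalBasis ℂ W
  have hnorm : ∀ v ∈ s, ‖K.starProjection (e v)‖ ^ 2 = ∑ i, ‖inner ℂ (e v) (u i : H)‖ ^ 2 := by
    intro v hv
    have := u.sum_sq_norm_inner_left ⟨_, hmem v hv⟩
    rw [Submodule.coe_norm] at this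
    rw [← this]
    refine Finset.sum_congr rfl fun i _ => ?_
    rw [Submodule.coe_inner, hmove v _ (hWK (u i).2)]
  -- After exchanging the sums, Bessel's inequality for `e` bounds the contribution of each basis
  -- vector of `W` by one, and `dim W ≤ #B`.
  calc ∑ v ∈ s, ‖K.starProjection (e v)‖ ^ 2
      = ∑ i, ∑ v ∈ s, ‖inner ℂ (e v) (u i : H)‖ ^ 2 := by
        rw [Finset.sum_comm]
        exact Finset.sum_congr rfl hnorm
    _ ≤ ∑ i, ‖(u i : H)‖ ^ 2 := Finset.sum_le_sum fun i _ => he.sum_inner_products_le _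
    _ = Module.finrank ℂ W := by
        have : ∀ i, ‖(u i : H)‖ = 1 := fun i => u.orthonormal.1 i
        simp [this]
    _ ≤ B.card := by
        exact_mod_cast (finrank_span_finset_le_card _).trans Finset.card_image_le

namespace PeriodicGraph

/-! ### The weighted space in terms of functions -/

section Weighted

variable {V : Type*} {m : V → ℝ} {hm : ∀ v, 0 < m v}

theorem inner_unitDelta (v : V) (f : WeightedL2 m hm) :
    inner ℂ (unitDelta m hm v) f = (Real.sqrt (m v) : ℂ) * toC m hm v (f v) := by
  classical
  have h : ((Real.sqrt (m v) : ℝ) : ℂ) ≠ 0 :=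
    Complex.ofReal_ne_zero.2 (Real.sqrt_pos.2 (hm v)).ne'
  have h2 : (m v : ℂ) = (Real.sqrt (m v) : ℂ) * (Real.sqrt (m v) : ℂ) := by
    rw [← Complex.ofReal_mul, Real.mul_self_sqrt (hm v).le]
  rw [unitDelta, lp.inner_single_left, fiber_inner, LinearEquiv.apply_symm_apply,
    Complex.conj_ofReal, Complex.ofReal_inv]
  conv_lhs => rw [h2]
  field_simp

theorem inner_unitDelta_eq_zero_iff (v : V) (f : WeightedL2 m hm) :
    inner ℂ (unitDelta m hm v) f = 0 ↔ toC m hm v (f v) = 0 := by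
  rw [inner_unitDelta, mul_eq_zero, or_iff_right]
  exact Complex.ofReal_ne_zero.2 (Real.sqrt_pos.2 (hm v)).ne'

theorem orthonormal_unitDelta : Orthonormal ℂ (unitDelta m hm) := by
  classical
  rw [orthonormal_iff_ite]
  intro v w
  rw [inner_unitDelta, unitDelta]
  split_ifs with h
  · subst h
    rw [lp.single_apply_self, LinearEquiv.apply_symm_apply, ← Complex.ofReal_mul,
      mul_inv_cancel₀ (Real.sqrt_pos.2 (hm v)).ne', Complex.ofReal_one]
  · rw [lp.single_apply_ne _ _ _ h, map_zero, mul_zero]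

theorem memlp_fiber_iff (g : ∀ v, Fiber m hm v) :
    Memℓp g 2 ↔ Summable fun v => m v * ‖toC m hm v (g v)‖ ^ 2 := by
  rw [memℓp_gen_iff (by norm_num)]
  simp only [ENNReal.toReal_ofNat, Real.rpow_ofNat, fiber_norm_sq]

theorem norm_sq_eq_tsum (f : WeightedL2 m hm) :
    ‖f‖ ^ 2 = ∑' v, m v * ‖toC m hm v (f v)‖ ^ 2 := by
  have h := lp.norm_rpow_eq_tsum (p := 2) (by norm_num) f
  simpa only [ENNReal.toReal_ofNat, Real.rpow_ofNat, fiber_norm_sq] using h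

end Weighted

/-! ### The `ℓ²`-eigenspace and its invariance under translations -/

section Eigenspace

variable {V : Type*} (G : SimpleGraph V) [G.LocallyFinite] (hdeg : ∀ v, 0 < G.degree v)

/-- The eigenspace `ker (Δ - E)` in `ℓ²(V, deg)`. -/
noncomputable def lapEigenspace (E : ℂ) : Submodule ℂ (GraphL2 G hdeg) :=
  (lapL2 G hdeg - E • ContinuousLinearMap.id ℂ (GraphL2 G hdeg)).ker

noncomputable instance (E : ℂ) : (lapEigenspace G hdeg E).HasOrthogonalProjection :=
  inferInstanceAs
    ((lapL2 G hdeg - E • ContinuousLinearMap.id ℂ (GraphL2 G hdeg)).ker).HasOrthogonalProjection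

variable {G hdeg}

theorem toFun_injective : Function.Injective (toFun G hdeg) := fun _ _ h =>
  lp.ext (funext fun v => (toC _ _ v).injective (congrFun h v))

theorem exists_toFun_eq {g : V → ℂ} (hg : Summable fun v => (G.degree v : ℝ) * ‖g v‖ ^ 2) :
    ∃ f : GraphL2 G hdeg, toFun G hdeg f = g :=
  ⟨⟨fun v => (toC _ (degree_weight_pos hdeg) v).symm (g v), (memlp_fiber_iff _).2 hg⟩, rfl⟩

theorem mem_lapEigenspace_iff {E : ℂ} {f : GraphL2 G hdeg} :
    f ∈ lapEigenspace G hdeg E ↔ lap G (toFun G hdeg f) = E • toFun G hdeg f := by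
  rw [lapEigenspace, LinearMap.mem_ker, ContinuousLinearMap.coe_coe, sub_apply,
    sub_eq_zero, ← toFun_injective.eq_iff, toFun_lapL2]
  rfl

variable {d : ℕ} [AddAction (Fin d → ℤ) V]

theorem IsPeriodic.degree_vadd (hG : IsPeriodic d G) (γ : Fin d → ℤ) (v : V) :
    G.degree (γ +ᵥ v) = G.degree v := by
  rw [← G.card_neighborFinset_eq_degree, hG.neighborFinset_vadd, Finset.card_map,
    G.card_neighborFinset_eq_degree]

/-- Translates of eigenfunctions are eigenfunctions. -/
theorem IsPeriodic.exists_translate (hG : IsPeriodic d G) {E : ℂ} {f : GraphL2 G hdeg}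
    (hf : f ∈ lapEigenspace G hdeg E) (γ : Fin d → ℤ) :
    ∃ g ∈ lapEigenspace G hdeg E, ‖g‖ = ‖f‖ ∧ ∀ v, toFun G hdeg g v = toFun G hdeg f (γ +ᵥ v) := by
  have hterm : (fun v => (G.degree v : ℝ) * ‖toFun G hdeg f (γ +ᵥ v)‖ ^ 2) =
      (fun v => (G.degree v : ℝ) * ‖toFun G hdeg f v‖ ^ 2) ∘ AddAction.toPerm γ := by
    funext v
    exact congrArg (fun n : ℕ => (n : ℝ) * ‖toFun G hdeg f (γ +ᵥ v)‖ ^ 2) (hG.degree_vadd γ v).symm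
  have hsum : Summable fun v => (G.degree v : ℝ) * ‖toFun G hdeg f v‖ ^ 2 :=
    (memlp_fiber_iff _).1 (lp.memℓp f)
  obtain ⟨g, hg⟩ := exists_toFun_eq (hdeg := hdeg)
    (g := fun v => toFun G hdeg f (γ +ᵥ v))
    (hterm ▸ (AddAction.toPerm γ).summable_iff.2 hsum)
  refine ⟨g, ?_, ?_, congrFun hg⟩
  · rw [mem_lapEigenspace_iff, hg, hG.lap_comp_vadd, mem_lapEigenspace_iff.1 hf]
    rfl
  · rw [← sq_eq_sq₀ (norm_nonneg _) (norm_nonneg _), norm_sq_eq_tsum, norm_sq_eq_tsum]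
    change ∑' v, (G.degree v : ℝ) * ‖toFun G hdeg g v‖ ^ 2 =
      ∑' v, (G.degree v : ℝ) * ‖toFun G hdeg f v‖ ^ 2
    rw [hg, hterm]
    exact (AddAction.toPerm γ).tsum_eq fun v => (G.degree v : ℝ) * ‖toFun G hdeg f v‖ ^ 2

theorem inner_self_starProjection {H : Type*} [NormedAddCommGroup H] [InnerProductSpace ℂ H]
    (K : Submodule ℂ H) [K.HasOrthogonalProjection] (x : H) :
    inner ℂ x (K.starProjection x) = ((‖K.starProjection x‖ ^ 2 : ℝ) : ℂ) := by
  conv_lhs => rw [← Submodule.starProjection_eq_self_iff.2 (K.starProjection_apply_mem x),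
    ← Submodule.inner_starProjection_left_eq_right]
  rw [inner_self_eq_norm_sq_to_K]
  push_cast
  rfl

/-- The diagonal of the projection onto an eigenspace is periodic. -/
theorem IsPeriodic.norm_starProjection_vadd_le (hG : IsPeriodic d G) (E : ℂ) (γ : Fin d → ℤ)
    (v : V) : ‖(lapEigenspace G hdeg E).starProjection (unitDelta _ _ (γ +ᵥ v))‖ ≤
      ‖(lapEigenspace G hdeg E).starProjection (unitDelta _ _ v)‖ := by
  set K := lapEigenspace G hdeg E
  set f := K.starProjection (unitDelta _ _ (γ +ᵥ v)) with hf
  have hfK : f ∈ K := K.starProjection_apply_mem _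
  -- Pulling `f` back by `γ` gives `‖f‖² = ⟪e_{γ+v}, f⟫ = ⟪e_v, g⟫ = ⟪P e_v, g⟫ ≤ ‖P e_v‖ ‖f‖`.
  obtain ⟨g, hgK, hgf, hg⟩ := hG.exists_translate hfK γ
  have h1 : inner ℂ (unitDelta _ _ (γ +ᵥ v)) f = inner ℂ (unitDelta _ _ v) g := by
    rw [inner_unitDelta, inner_unitDelta]
    have : toC _ _ v (g v) = toC _ _ (γ +ᵥ v) (f (γ +ᵥ v)) := hg v
    rw [this, hG.degree_vadd]
  have h2 : inner ℂ (unitDelta _ _ v) g = inner ℂ (K.starProjection (unitDelta _ _ v)) g := by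
    rw [Submodule.inner_starProjection_left_eq_right, Submodule.starProjection_eq_self_iff.2 hgK]
  have h3 := norm_inner_le_norm (𝕜 := ℂ) (K.starProjection (unitDelta _ _ v)) g
  rw [← h2, ← h1, hf, inner_self_starProjection, Complex.norm_real, ← hf, hgf,
    Real.norm_of_nonneg (sq_nonneg _), sq] at h3
  rcases (norm_nonneg f).eq_or_lt with h0 | h0
  · rw [← h0]
    exact norm_nonneg _
  · exact le_of_mul_le_mul_right h3 h0

theorem IsPeriodic.norm_starProjection_vadd (hG : IsPeriodic d G) (E : ℂ) (γ : Fin d → ℤ)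
    (v : V) : ‖(lapEigenspace G hdeg E).starProjection (unitDelta _ _ (γ +ᵥ v))‖ =
      ‖(lapEigenspace G hdeg E).starProjection (unitDelta _ _ v)‖ := by
  refine le_antisymm (hG.norm_starProjection_vadd_le E γ v) ?_
  conv_lhs => rw [← neg_vadd_vadd γ v]
  exact hG.norm_starProjection_vadd_le E (-γ) (γ +ᵥ v)

/-- A nonzero eigenspace is seen from the fundamental domain. -/
theorem exists_starProjection_unitDelta_ne_zero {Q : Finset V} (hG : IsPeriodic d G)
    (hQ : IsFundamentalDomain d Q) {E : ℂ} (hE : lapEigenspace G hdeg E ≠ ⊥) :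
    ∃ q ∈ Q, (lapEigenspace G hdeg E).starProjection (unitDelta _ _ q) ≠ 0 := by
  obtain ⟨f, hfK, hf0⟩ := (Submodule.ne_bot_iff _).1 hE
  by_contra! hall
  refine hf0 (toFun_injective (funext fun v => ?_))
  change toC _ _ v (f v) = 0
  rw [← inner_unitDelta_eq_zero_iff, ← Submodule.starProjection_eq_self_iff.2 hfK,
    ← Submodule.inner_starProjection_left_eq_right, ← orbitShift_vadd_orbitRep hQ v,
    norm_eq_zero.1 ((hG.norm_starProjection_vadd E _ _).trans
      (norm_eq_zero.2 (hall _ (orbitRep hQ v).2))), inner_zero_left]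

/-- Square-summable eigenfunctions correspond to the eigenspace in `ℓ²(V, deg)`. -/
theorem exists_memlp_eigenfunction_iff {Q : Finset V} (hG : IsPeriodic d G)
    (hQ : IsFundamentalDomain d Q) (E : ℂ) :
    (∃ f : V → ℂ, f ≠ 0 ∧ Memℓp f 2 ∧ lap G f = E • f) ↔ lapEigenspace G hdeg E ≠ ⊥ := by
  have hmem : ∀ g : V → ℂ, Memℓp g 2 ↔ Summable fun v => ‖g v‖ ^ 2 := fun g => by
    rw [memℓp_gen_iff (by norm_num)]
    simp only [ENNReal.toReal_ofNat, Real.rpow_ofNat]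
  rw [Submodule.ne_bot_iff]
  constructor
  · rintro ⟨g, hg0, hg, hgE⟩
    -- All degrees occur on `Q`, so they lie between `1` and a finite maximum, and the weighted and
    -- unweighted `ℓ²` conditions agree.
    have hD : ∀ v, (G.degree v : ℝ) ≤ ((Q.sup fun q => G.degree q : ℕ) : ℝ) := by
      intro v
      rw [← orbitShift_vadd_orbitRep hQ v, hG.degree_vadd, Nat.cast_le]
      exact Finset.le_sup (f := fun q => G.degree q) (orbitRep hQ v).2
    obtain ⟨f, rfl⟩ := exists_toFun_eq (hdeg := hdeg) (g := g)
      (Summable.of_nonneg_of_le (fun v => mul_nonneg (Nat.cast_nonneg _) (sq_nonneg _))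
        (fun v => mul_le_mul_of_nonneg_right (hD v) (sq_nonneg _))
        (((hmem g).1 hg).mul_left _))
    exact ⟨f, mem_lapEigenspace_iff.2 hgE, fun h0 => hg0 (by rw [h0]; rfl)⟩
  · rintro ⟨f, hf, hf0⟩
    refine ⟨toFun G hdeg f, fun h0 => hf0 (toFun_injective h0), ?_, mem_lapEigenspace_iff.1 hf⟩
    rw [hmem]
    refine Summable.of_nonneg_of_le (fun v => sq_nonneg _) (fun v => ?_)
      ((memlp_fiber_iff _).1 (lp.memℓp f))
    exact le_mul_of_one_le_left (sq_nonneg _) (Nat.one_le_cast.2 (hdeg v))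

end Eigenspace

/-! ### Square-summable eigenfunctions force finitely supported ones -/

section Folner

variable {V : Type*} {G : SimpleGraph V} [G.LocallyFinite] {hdeg : ∀ v, 0 < G.degree v}
  {d : ℕ} [AddAction (Fin d → ℤ) V] {Q : Finset V}

/-- Every edge is a translate of one that starts in the finite set `Q`, so edges have bounded length
in the `ℤ^d` coordinate. This length fixes the shell thickness needed for truncation. -/
theorem IsPeriodic.exists_range (hG : IsPeriodic d G) (hQ : IsFundamentalDomain d Q) :
    ∃ R : ℕ, ∀ v w, G.Adj v w → ∀ i, |orbitShift hQ w i - orbitShift hQ v i| ≤ R := by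
  refine ⟨Q.sup fun q => (G.neighborFinset q).sup fun w =>
    Finset.univ.sup fun i => (orbitShift hQ w i).natAbs, fun v w hvw i => ?_⟩
  set γ := orbitShift hQ v with hγ
  set q := orbitRep hQ v
  have hv : γ +ᵥ (q : V) = v := orbitShift_vadd_orbitRep hQ v
  have hadj : -γ +ᵥ w ∈ G.neighborFinset (q : V) := by
    rw [SimpleGraph.mem_neighborFinset, ← hG.adj_iff γ, hv, vadd_neg_vadd]
    exact hvw
  have hw : orbitShift hQ w i - γ i = orbitShift hQ (-γ +ᵥ w) i := by
    rw [hG.orbitShift_vadd, Pi.add_apply, Pi.neg_apply]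
    ring
  rw [hw, Int.abs_eq_natAbs, Nat.cast_le]
  refine le_trans ?_ (Finset.le_sup (f := fun q => (G.neighborFinset q).sup fun w =>
    Finset.univ.sup fun i => (orbitShift hQ w i).natAbs) q.2)
  refine le_trans ?_ (Finset.le_sup (f := fun w =>
    Finset.univ.sup fun i => (orbitShift hQ w i).natAbs) hadj)
  exact Finset.le_sup (f := fun i => (orbitShift hQ (-γ +ᵥ w) i).natAbs) (Finset.mem_univ i)

/-- The box `[a, b)^d` in `ℤ^d`. -/
noncomputable def box (d : ℕ) (a b : ℤ) : Finset (Fin d → ℤ) := Fintype.piFinset fun _ => Finset.Ico a b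

theorem mem_box {a b : ℤ} {γ : Fin d → ℤ} : γ ∈ box d a b ↔ ∀ i, a ≤ γ i ∧ γ i < b := by
  simp [box]

theorem card_box (a : ℤ) (n : ℕ) : (box d a (a + n)).card = n ^ d := by
  simp [box]

/-- If an eigenfunction vanishes near the boundary of a box, then its restriction to the box is
a finitely supported eigenfunction. -/
theorem lap_truncate (hQ : IsFundamentalDomain d Q) {R : ℕ}
    (hR : ∀ v w, G.Adj v w → ∀ i, |orbitShift hQ w i - orbitShift hQ v i| ≤ R) (n : ℤ) {E : ℂ}
    {f : V → ℂ} (hf : lap G f = E • f)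
    (h0 : ∀ v, orbitShift hQ v ∈ box d 0 n \ box d (2 * R) (n - 2 * R) → f v = 0) :
    lap G (fun v => if orbitShift hQ v ∈ box d 0 n then f v else 0) =
      E • fun v => if orbitShift hQ v ∈ box d 0 n then f v else 0 := by
  set h : V → ℂ := fun v => if orbitShift hQ v ∈ box d 0 n then f v else 0 with hh
  have hz : ∀ v, orbitShift hQ v ∉ box d (2 * R) (n - 2 * R) → h v = 0 := by
    intro v hv
    by_cases hv' : orbitShift hQ v ∈ box d 0 n
    · rw [hh]
      simp only [if_pos hv', h0 v (Finset.mem_sdiff.2 ⟨hv', hv⟩)]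
    · exact if_neg hv'
  funext v
  -- Within the box shrunk by `R`, all neighbours stay in the big box and the truncation is
  -- invisible. Elsewhere `v` and its neighbours avoid the box shrunk by `2 * R`, where alone `h`
  -- can be nonzero.
  by_cases hv : orbitShift hQ v ∈ box d R (n - R)
  · have e0 : h v = f v := if_pos (mem_box.2 fun i => by
      have := mem_box.1 hv i
      omega)
    have e1 : ∀ w ∈ G.neighborFinset v, h w = f w := fun w hw => if_pos (mem_box.2 fun i => by
      have h1 := mem_box.1 hv i
      have h2 := abs_le.1 (hR v w ((SimpleGraph.mem_neighborFinset ..).1 hw) i)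
      omega)
    have h2 : lap G f v = E * f v := congrFun hf v
    change h v - (G.degree v : ℂ)⁻¹ * ∑ w ∈ G.neighborFinset v, h w = E * h v
    rw [Finset.sum_congr rfl e1, e0]
    exact h2
  · have hi : ∃ i, ¬ (R ≤ orbitShift hQ v i ∧ orbitShift hQ v i < n - R) := by
      by_contra! hcon
      exact hv (mem_box.2 hcon)
    obtain ⟨i, hi⟩ := hi
    have e0 : h v = 0 := hz v fun hb => hi (by
      have := mem_box.1 hb i
      omega)
    have e1 : ∀ w ∈ G.neighborFinset v, h w = 0 := fun w hw => hz w fun hb => hi (by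
      have h1 := mem_box.1 hb i
      have h2 := abs_le.1 (hR v w ((SimpleGraph.mem_neighborFinset ..).1 hw) i)
      omega)
    change h v - (G.degree v : ℂ)⁻¹ * ∑ w ∈ G.neighborFinset v, h w = E * h v
    rw [Finset.sum_congr rfl e1, e0]
    simp

/-- If `Δ` has no finitely supported eigenfunction at `E`, then the diagonal of the projection onto
`ker (Δ - E)` is bounded by the relative size of the boundary of a box. -/
theorem norm_starProjection_sq_mul_le (hG : IsPeriodic d G) (hQ : IsFundamentalDomain d Q) {R : ℕ}
    (hR : ∀ v w, G.Adj v w → ∀ i, |orbitShift hQ w i - orbitShift hQ v i| ≤ R) {E : ℂ}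
    (hE : ¬ ∃ f : V → ℂ, f ≠ 0 ∧ (Function.support f).Finite ∧ lap G f = E • f) {q : V}
    (hq : q ∈ Q) (n : ℕ) :
    ‖(lapEigenspace G hdeg E).starProjection (unitDelta _ _ q)‖ ^ 2 * ((n + 4 * R : ℕ) : ℝ) ^ d ≤
      (((n + 4 * R : ℕ) : ℝ) ^ d - (n : ℝ) ^ d) * Q.card := by
  classical
  -- Removing `2 * R` on each side leaves an inner box of side exactly `n`.
  set N : ℕ := n + 4 * R with hN
  set K := lapEigenspace G hdeg E
  set e := hG.vertexEquiv hQ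
  set outer := box d 0 N with houter
  set inner' := box d (2 * R) (N - 2 * R) with hinner
  have hsub : inner' ⊆ outer := fun γ hγ => mem_box.2 fun i => by
    have := mem_box.1 hγ i
    omega
  have hco : outer.card = N ^ d := by
    have := card_box (d := d) 0 N
    rwa [zero_add] at this
  have hci : inner'.card = n ^ d := by
    have := card_box (d := d) (2 * R) n
    rwa [show (2 * R + n : ℤ) = N - 2 * R by rw [hN]; push_cast; ring] at this
  have key := (orthonormal_unitDelta (m := fun v => (G.degree v : ℝ))
    (hm := degree_weight_pos hdeg)).sum_norm_starProjection_sq_le_card K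
    ((outer ×ˢ Finset.univ).map e.toEmbedding)
    (((outer \ inner') ×ˢ Finset.univ).map e.toEmbedding) (by
      intro f hf hB v hv
      have hB' : ∀ v, orbitShift hQ v ∈ outer \ inner' → toFun G hdeg f v = 0 := by
        intro w hw
        refine (inner_unitDelta_eq_zero_iff w f).1 (hB w ?_)
        rw [Finset.mem_map_equiv]
        exact Finset.mem_product.2 ⟨hw, Finset.mem_univ _⟩
      have hv' : orbitShift hQ v ∈ outer := by
        rw [Finset.mem_map_equiv] at hv
        exact (Finset.mem_product.1 hv).1
      have htr := lap_truncate hQ hR N (mem_lapEigenspace_iff.1 hf) hB'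
      rw [inner_unitDelta_eq_zero_iff]
      by_contra hne
      refine hE ⟨_, fun h0 => hne ?_, ?_, htr⟩
      · have := congrFun h0 v
        simp only [← houter, if_pos hv'] at this
        exact this
      · refine ((outer ×ˢ Finset.univ).map e.toEmbedding).finite_toSet.subset fun w hw => ?_
        rw [Finset.mem_coe, Finset.mem_map_equiv]
        refine Finset.mem_product.2 ⟨?_, Finset.mem_univ _⟩
        by_contra hw'
        exact hw (if_neg hw'))
  rw [Finset.sum_map, Finset.card_map, Finset.card_product, Finset.card_sdiff_of_subset hsub, hco,
    hci, Finset.sum_product, Finset.card_univ, Fintype.card_coe, Nat.cast_mul,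
    Nat.cast_sub (Nat.pow_le_pow_left (by omega) d), Nat.cast_pow, Nat.cast_pow] at key
  -- Only the orbit of `q` is kept on the left: it contributes one equal term for each of the `N ^
  -- d` translations in the box.
  refine le_trans ?_ key
  rw [mul_comm, ← Nat.cast_pow, ← hco, ← nsmul_eq_mul]
  refine Finset.card_nsmul_le_sum _ _ _ fun γ _ => ?_
  refine le_trans (le_of_eq ?_) (Finset.single_le_sum (fun q _ => sq_nonneg _)
    (Finset.mem_univ (⟨q, hq⟩ : Q)))
  rw [← hG.norm_starProjection_vadd E γ q]
  rfl

/-- If `Δ` has a square-summable eigenfunction then it has a finitely supported one. -/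
theorem exists_finite_support_of_lapEigenspace_ne_bot (hG : IsPeriodic d G)
    (hQ : IsFundamentalDomain d Q) {E : ℂ} (hK : lapEigenspace G hdeg E ≠ ⊥) :
    ∃ f : V → ℂ, f ≠ 0 ∧ (Function.support f).Finite ∧ lap G f = E • f := by
  by_contra hE
  obtain ⟨q, hq, hne⟩ := exists_starProjection_unitDelta_ne_zero hG hQ hK
  obtain ⟨R, hR⟩ := hG.exists_range hQ
  set t := ‖(lapEigenspace G hdeg E).starProjection (unitDelta _ _ q)‖ ^ 2
  have ht : 0 < t := pow_pos (norm_pos_iff.2 hne) 2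
  have hlim : Filter.Tendsto (fun n : ℕ => (1 - ((n : ℝ) / ((n : ℝ) + (4 * R : ℕ))) ^ d) * Q.card)
      Filter.atTop (nhds 0) := by
    have h1 : Filter.Tendsto (fun n : ℕ => (n : ℝ) / ((n : ℝ) + (4 * R : ℕ))) Filter.atTop
        (nhds 1) := tendsto_natCast_div_add_atTop _
    simpa using ((h1.pow d).const_sub 1).mul_const (Q.card : ℝ)
  refine ht.not_ge (ge_of_tendsto hlim ?_)
  -- Positivity of `n` keeps the denominator nonzero even if `R = 0`.
  filter_upwards [Filter.eventually_gt_atTop 0] with n hn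
  have hpos : (0 : ℝ) < (n : ℝ) + (4 * R : ℕ) := by positivity
  have h := norm_starProjection_sq_mul_le (hdeg := hdeg) hG hQ hR hE hq n
  rw [Nat.cast_add] at h
  rw [div_pow, one_sub_div (pow_pos hpos d).ne', div_mul_eq_mul_div, le_div_iff₀ (pow_pos hpos d)]
  exact h

end Folner

end PeriodicGraph

namespace PeriodicGraph

/-! ### Spectral projectors of a self-adjoint operator -/

section Spectral

variable {H : Type*} [NormedAddCommGroup H] [InnerProductSpace ℂ H] [CompleteSpace H]

/-- The positive part `(A - E)₊`. -/
noncomputable def posPartSub (A : H →L[ℂ] H) (E : ℝ) : H →L[ℂ] H :=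
  cfc (fun x : ℝ => max (x - E) 0) A

/-- The spectral subspace of `A` for `(-∞, E]`. -/
noncomputable def spectralIic (A : H →L[ℂ] H) (E : ℝ) : Submodule ℂ H := (posPartSub A E).ker

noncomputable instance (A : H →L[ℂ] H) (E : ℝ) : (spectralIic A E).HasOrthogonalProjection :=
  inferInstanceAs ((posPartSub A E).ker).HasOrthogonalProjection

theorem spectralProjIic_eq (A : H →L[ℂ] H) (E : ℝ) :
    spectralProjIic A E = (spectralIic A E).starProjection := rfl

theorem mem_spectralIic {A : H →L[ℂ] H} {E : ℝ} {f : H} :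
    f ∈ spectralIic A E ↔ posPartSub A E f = 0 := Iff.rfl

variable {A : H →L[ℂ] H}

theorem isSelfAdjoint_cfc_real (g : ℝ → ℝ) : IsSelfAdjoint (cfc g A) := cfc_predicate g A

theorem inner_cfc_left (g : ℝ → ℝ) (x y : H) : inner ℂ (cfc g A x) y = inner ℂ x (cfc g A y) :=
  (ContinuousLinearMap.isSelfAdjoint_iff_isSymmetric.1 (isSelfAdjoint_cfc_real g)) x y

theorem cfc_sub_const (hA : IsSelfAdjoint A) (E : ℝ) :
    cfc (fun x : ℝ => x - E) A = A - (E : ℂ) • ContinuousLinearMap.id ℂ H := by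
  rw [cfc_sub (fun x => x) (fun _ => E) A, cfc_id' ℝ A, cfc_const E A, Algebra.algebraMap_eq_smul_one]
  rfl

theorem cfc_mul_apply {g h : ℝ → ℝ} (hg : Continuous g) (hh : Continuous h) (f : H) :
    cfc (fun x => g x * h x) A f = cfc g A (cfc h A f) := by
  rw [cfc_mul g h A hg.continuousOn hh.continuousOn]
  rfl

/-- For `E < E'`, `(x - E')₊` is a continuous multiple of `(x - E)₊`. The denominator `max (x - E)
(E' - E)` equals `x - E` wherever the numerator is nonzero, and stays positive. -/
theorem spectralIic_mono : Monotone (spectralIic A) := by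
  intro E E' h f hf
  rcases h.eq_or_lt with rfl | h
  · exact hf
  rw [mem_spectralIic] at hf ⊢
  have hpos : ∀ x : ℝ, 0 < max (x - E) (E' - E) := fun x => lt_max_of_lt_right (sub_pos.2 h)
  have hfac : (fun x : ℝ => max (x - E') 0) =
      fun x => max (x - E') 0 / max (x - E) (E' - E) * max (x - E) 0 := by
    funext x
    rcases le_total x E' with hx | hx
    · rw [max_eq_right (sub_nonpos.2 hx), zero_div, zero_mul]
    · rw [max_eq_left (a := x - E) (by linarith), max_eq_left (a := x - E) (by linarith),
        div_mul_cancel₀ _ (by linarith)]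
  rw [posPartSub, hfac, cfc_mul_apply _ (by fun_prop), ← posPartSub, hf, map_zero]
  exact (by fun_prop : Continuous fun x : ℝ => max (x - E') 0).div (by fun_prop)
    fun x => (hpos x).ne'

theorem norm_cfc_sub_cfc_le {g h : ℝ → ℝ} (hg : Continuous g) (hh : Continuous h) {c : ℝ}
    (hc : 0 ≤ c) (hgh : ∀ x, |g x - h x| ≤ c) : ‖cfc g A - cfc h A‖ ≤ c := by
  rw [← cfc_sub g h A hg.continuousOn hh.continuousOn]
  exact norm_cfc_le hc fun x _ => hgh x

/-- The calculus is norm continuous for uniform perturbations of the function, so a vanishing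
condition passes to the limit in the parameter. It serves `(x - E)₊` from the right and `(E - x)₊`
from the left. -/
theorem cfc_apply_eq_zero_of_forall {g : ℝ → ℝ → ℝ} {E : ℝ} {s : Set ℝ}
    (hs : ∀ ε > 0, ∃ E' ∈ s, |E' - E| < ε) (hg : ∀ E, Continuous (g E))
    (hgE : ∀ E' x, |g E x - g E' x| ≤ |E' - E|) {f : H} (hf : ∀ E' ∈ s, cfc (g E') A f = 0) :
    cfc (g E) A f = 0 := by
  rw [← norm_le_zero_iff]
  refine le_of_forall_pos_le_add fun ε hε => ?_
  rw [zero_add]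
  have hpos : (0 : ℝ) < ‖f‖ + 1 := by positivity
  obtain ⟨E', hE', hlt⟩ := hs (ε / (‖f‖ + 1)) (div_pos hε hpos)
  calc ‖cfc (g E) A f‖ = ‖(cfc (g E) A - cfc (g E') A) f‖ := by
        rw [sub_apply, hf E' hE', sub_zero]
    _ ≤ ‖cfc (g E) A - cfc (g E') A‖ * ‖f‖ := ContinuousLinearMap.le_opNorm _ _
    _ ≤ ε / (‖f‖ + 1) * (‖f‖ + 1) := by
        gcongr
        · exact (norm_cfc_sub_cfc_le (hg _) (hg _) (abs_nonneg _) (hgE E')).trans hlt.le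
        · linarith
    _ = ε := div_mul_cancel₀ _ hpos.ne'

theorem abs_max_sub_max_le (a b : ℝ) : |max a 0 - max b 0| ≤ |a - b| :=
  abs_max_sub_max_le_abs a b 0

/-- Right continuity of the spectral subspaces. -/
theorem iInf_spectralIic (E : ℝ) : ⨅ E' : Set.Ioi E, spectralIic A E' = spectralIic A E := by
  refine le_antisymm (fun f hf => ?_) (le_iInf fun E' => spectralIic_mono (le_of_lt E'.2))
  rw [Submodule.mem_iInf] at hf
  refine cfc_apply_eq_zero_of_forall (s := Set.Ioi E) (g := fun E x => max (x - E) 0)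
    (fun ε hε => ⟨E + ε / 2, by simpa using hε, ?_⟩) (fun E => by fun_prop) (fun E' x => ?_)
    fun E' hE' => hf ⟨E', hE'⟩
  · rw [add_sub_cancel_left, abs_of_pos (by linarith)]
    linarith
  · refine (abs_max_sub_max_le _ _).trans (le_of_eq ?_)
    congr 1
    ring

/-- Vectors of the spectral subspace at `E` orthogonal to the earlier ones are eigenvectors. -/
theorem eigenvector_of_mem_spectralIic (hA : IsSelfAdjoint A) {E : ℝ} {f : H}
    (hf : f ∈ spectralIic A E) (horth : ∀ E' < E, f ∈ (spectralIic A E')ᗮ) :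
    f ∈ (A - (E : ℂ) • ContinuousLinearMap.id ℂ H).ker := by
  have hneg : cfc (fun x : ℝ => max (E - x) 0) A f = 0 := by
    refine cfc_apply_eq_zero_of_forall (s := Set.Iio E) (g := fun E x => max (E - x) 0)
      (fun ε hε => ⟨E - ε / 2, by simpa using hε, ?_⟩) (fun E => by fun_prop) (fun E' x => ?_)
      fun E' hE' => ?_
    · rw [sub_sub_cancel_left, abs_neg, abs_of_pos (by linarith)]
      linarith
    · refine (abs_max_sub_max_le _ _).trans (le_of_eq ?_)
      rw [abs_sub_comm]
      congr 1
      ring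
    -- Since `(x - E')₊ (E' - x)₊ = 0`, the range of `(E' - A)₊` lies in the spectral subspace at
    -- `E'`, to which `f` is orthogonal.
    · rw [← inner_self_eq_zero (𝕜 := ℂ), ← inner_cfc_left]
      refine (horth E' hE') _ ?_
      rw [mem_spectralIic, posPartSub, ← cfc_mul_apply (by fun_prop) (by fun_prop)]
      have : (fun x : ℝ => max (x - E') 0 * max (E' - x) 0) = fun _ => 0 := by
        funext x
        rcases le_total x E' with hx | hx
        · rw [max_eq_right (sub_nonpos.2 hx), zero_mul]
        · rw [max_eq_right (a := E' - x) (sub_nonpos.2 hx), mul_zero]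
      rw [this, cfc_const_zero]
      rfl
  have hsub : (fun x : ℝ => x - E) = fun x => max (x - E) 0 - max (E - x) 0 := by
    funext x
    rcases le_total x E with hx | hx
    · rw [max_eq_right (sub_nonpos.2 hx), max_eq_left (sub_nonneg.2 hx)]
      ring
    · rw [max_eq_left (sub_nonneg.2 hx), max_eq_right (sub_nonpos.2 hx), sub_zero]
  change (A - (E : ℂ) • ContinuousLinearMap.id ℂ H) f = 0
  rw [← cfc_sub_const hA, hsub, cfc_sub _ _ A (by fun_prop) (by fun_prop), sub_apply, hneg,
    sub_zero]
  exact hf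

/-- From `(x - E)₊² = (x - E)₊ (x - E)` one gets `‖(A - E)₊ f‖² = 0`. -/
theorem eigenvector_mem_spectralIic (hA : IsSelfAdjoint A) {E : ℝ} {f : H}
    (hf : f ∈ (A - (E : ℂ) • ContinuousLinearMap.id ℂ H).ker) : f ∈ spectralIic A E := by
  have hf' : (A - (E : ℂ) • ContinuousLinearMap.id ℂ H) f = 0 := hf
  rw [← cfc_sub_const hA] at hf'
  rw [mem_spectralIic, posPartSub, ← inner_self_eq_zero (𝕜 := ℂ), ← inner_cfc_left,
    ← cfc_mul_apply (by fun_prop) (by fun_prop)]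
  have : (fun x : ℝ => max (x - E) 0 * max (x - E) 0) = fun x => max (x - E) 0 * (x - E) := by
    funext x
    rcases le_total x E with hx | hx
    · rw [max_eq_right (sub_nonpos.2 hx), zero_mul, zero_mul]
    · rw [max_eq_left (sub_nonneg.2 hx)]
  rw [this, cfc_mul_apply (by fun_prop) (by fun_prop), hf', map_zero, inner_zero_left]

/-- The function `(x - E')₊ - (E - E')` is a continuous multiple of `x - E`, so `f` is an
eigenvector of the self-adjoint `(A - E')₊` with the nonzero eigenvalue `E - E'`, hence orthogonal
to its kernel. -/
theorem eigenvector_mem_orthogonal (hA : IsSelfAdjoint A) {E E' : ℝ} (hE : E' < E) {f : H}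
    (hf : f ∈ (A - (E : ℂ) • ContinuousLinearMap.id ℂ H).ker) : f ∈ (spectralIic A E')ᗮ := by
  have hf' : (A - (E : ℂ) • ContinuousLinearMap.id ℂ H) f = 0 := hf
  rw [← cfc_sub_const hA] at hf'
  have hpos : ∀ x : ℝ, 0 < max (E - x) (E - E') := fun x => lt_max_of_lt_right (sub_pos.2 hE)
  have hfac : (fun x : ℝ => max (x - E') 0 - (E - E')) =
      fun x => (E - E') / max (E - x) (E - E') * (x - E) := by
    funext x
    have h0 := hpos x
    rcases le_total x E' with hx | hx
    · have h1 : E - x ≠ 0 := by linarith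
      rw [max_eq_right (sub_nonpos.2 hx), max_eq_left (by linarith)]
      field_simp
      ring
    · rw [max_eq_left (sub_nonneg.2 hx), max_eq_right (by linarith),
        div_self (sub_pos.2 hE).ne']
      ring
  have hcont : Continuous fun x : ℝ => (E - E') / max (E - x) (E - E') :=
    continuous_const.div (by fun_prop) fun x => (hpos x).ne'
  have h1 : cfc (fun x : ℝ => max (x - E') 0 - (E - E')) A f = 0 := by
    rw [hfac, cfc_mul_apply hcont (by fun_prop), hf', map_zero]
  have h2 : posPartSub A E' f = ((E - E' : ℝ) : ℂ) • f := by
    rw [cfc_sub _ _ A (by fun_prop) (by fun_prop), cfc_const _ A, sub_apply, sub_eq_zero] at h1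
    rw [posPartSub, h1, Algebra.algebraMap_eq_smul_one]
    rfl
  intro g hg
  have h3 : inner ℂ g (posPartSub A E' f) = 0 := by
    rw [posPartSub, ← inner_cfc_left, ← posPartSub, mem_spectralIic.1 hg, inner_zero_left]
  rw [h2, inner_smul_right, mul_eq_zero] at h3
  exact h3.resolve_left (Complex.ofReal_ne_zero.2 (sub_pos.2 hE).ne')

/-- Strong right continuity of the spectral projectors. -/
theorem tendsto_spectralIic_right (E : ℝ) (x : H) :
    Filter.Tendsto (fun E' => (spectralIic A E').starProjection x) (nhdsWithin E (Set.Ioi E))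
      (nhds ((spectralIic A E).starProjection x)) := by
  rw [← tendsto_comp_coe_Ioi_atBot]
  -- The orthogonal complements increase as `E'` decreases to `E`, so the convergence theorem for
  -- increasing families applies to them.
  have hU : Monotone fun i : (Set.Ioi E)ᵒᵈ => (spectralIic A (OrderDual.ofDual i : Set.Ioi E))ᗮ :=
    fun i j hij => Submodule.orthogonal_le (spectralIic_mono hij)
  have h := Submodule.starProjection_tendsto_closure_iSup _ hU x
  have hcl : (⨆ i : (Set.Ioi E)ᵒᵈ,
      (spectralIic A (OrderDual.ofDual i : Set.Ioi E))ᗮ).topologicalClosure =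
        (spectralIic A E)ᗮ := by
    rw [← Submodule.orthogonal_orthogonal_eq_closure, ← Submodule.iInf_orthogonal]
    simp only [Submodule.orthogonal_orthogonal]
    rw [← iInf_spectralIic E]
    rfl
  simp only [hcl, Submodule.starProjection_orthogonal'] at h
  have h' := h.const_sub x
  simp only [sub_apply, one_apply_eq_self, sub_sub_cancel] at h'
  exact h'

/-- Strong left continuity of the spectral projectors away from eigenvalues. -/
theorem tendsto_spectralIic_left (hA : IsSelfAdjoint A) {E : ℝ}
    (hE : (A - (E : ℂ) • ContinuousLinearMap.id ℂ H).ker = ⊥) (x : H) :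
    Filter.Tendsto (fun E' => (spectralIic A E').starProjection x) (nhdsWithin E (Set.Iio E))
      (nhds ((spectralIic A E).starProjection x)) := by
  rw [← tendsto_comp_coe_Iio_atTop]
  have hU : Monotone fun i : Set.Iio E => spectralIic A i := fun i j hij => spectralIic_mono hij
  have h := Submodule.starProjection_tendsto_closure_iSup _ hU x
  have hcl : (⨆ i : Set.Iio E, spectralIic A i).topologicalClosure = spectralIic A E := by
    set S := ⨆ i : Set.Iio E, spectralIic A i
    have hle : S.topologicalClosure ≤ spectralIic A E :=
      Submodule.topologicalClosure_minimal _ (iSup_le fun i => spectralIic_mono (le_of_lt i.2))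
        (posPartSub A E).isClosed_ker
    refine le_antisymm hle fun y hy => ?_
    have hz : y - S.topologicalClosure.starProjection y ∈ (S.topologicalClosure)ᗮ :=
      Submodule.sub_starProjection_mem_orthogonal _
    -- The residual lies in the spectral subspace at `E` and is orthogonal to all earlier ones. It
    -- is thus in the eigenspace, which is trivial.
    have hz0 : y - S.topologicalClosure.starProjection y = 0 := by
      have := eigenvector_of_mem_spectralIic hA
        (Submodule.sub_mem _ hy (hle (Submodule.starProjection_apply_mem _ y))) fun E' hE' =>
          Submodule.orthogonal_le ((le_iSup (fun i : Set.Iio E => spectralIic A i)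
            ⟨E', hE'⟩).trans S.le_topologicalClosure) hz
      rwa [hE, Submodule.mem_bot] at this
    rw [sub_eq_zero.1 hz0]
    exact Submodule.starProjection_apply_mem _ y
  simpa only [hcl] using h

theorem continuousAt_spectralIic (hA : IsSelfAdjoint A) {E : ℝ}
    (hE : (A - (E : ℂ) • ContinuousLinearMap.id ℂ H).ker = ⊥) (x : H) :
    ContinuousAt (fun E' => (spectralIic A E').starProjection x) E :=
  continuousAt_iff_continuous_left'_right'.2
    ⟨tendsto_spectralIic_left hA hE x, tendsto_spectralIic_right E x⟩

/-- The spectral projectors jump at `E` at least by the projection onto the eigenspace. -/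
theorem norm_sq_add_norm_sq_le_spectralIic (hA : IsSelfAdjoint A) {E E' : ℝ} (hE : E' < E)
    (x : H) : ‖(spectralIic A E').starProjection x‖ ^ 2 +
      ‖((A - (E : ℂ) • ContinuousLinearMap.id ℂ H).ker).starProjection x‖ ^ 2 ≤
        ‖(spectralIic A E).starProjection x‖ ^ 2 := by
  set L := (A - (E : ℂ) • ContinuousLinearMap.id ℂ H).ker
  have hsub : ∀ (U : Submodule ℂ H) [U.HasOrthogonalProjection], U ≤ spectralIic A E →
      inner ℂ (U.starProjection x) ((spectralIic A E).starProjection x) =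
        ((‖U.starProjection x‖ ^ 2 : ℝ) : ℂ) := by
    intro U _ hU
    rw [← Submodule.inner_starProjection_left_eq_right,
      Submodule.starProjection_eq_self_iff.2 (hU (U.starProjection_apply_mem x)),
      ← inner_conj_symm, inner_self_starProjection, Complex.conj_ofReal]
  have ha := hsub (spectralIic A E') (spectralIic_mono hE.le)
  have hb := hsub L fun f hf => eigenvector_mem_spectralIic hA hf
  set a := (spectralIic A E').starProjection x
  set b := L.starProjection x
  set y := (spectralIic A E).starProjection x
  have hab : inner ℂ a b = 0 :=
    (eigenvector_mem_orthogonal hA hE (L.starProjection_apply_mem x)) a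
      (Submodule.starProjection_apply_mem _ x)
  have h1 : ‖a + b‖ ^ 2 = ‖a‖ ^ 2 + ‖b‖ ^ 2 := by
    rw [norm_add_sq (𝕜 := ℂ), hab]
    simp
  -- Here `⟪a + b, y⟫ = ‖a‖² + ‖b‖² = ‖a + b‖²`, so the claim is `0 ≤ ‖a + b - y‖²`.
  have h2 := norm_sub_sq (𝕜 := ℂ) (a + b) y
  rw [inner_add_left, ha, hb, h1, ← Complex.ofReal_add] at h2
  have h3 : RCLike.re ((‖a‖ ^ 2 + ‖b‖ ^ 2 : ℝ) : ℂ) = ‖a‖ ^ 2 + ‖b‖ ^ 2 := Complex.ofReal_re _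
  rw [h3] at h2
  nlinarith [sq_nonneg ‖a + b - y‖]

end Spectral

/-! ### Continuity of the integrated density of states -/

section IDS

variable {V : Type*} {G : SimpleGraph V} [G.LocallyFinite] {hdeg : ∀ v, 0 < G.degree v}

theorem trace_indicatorMul_comp {m : V → ℝ} {hm : ∀ v, 0 < m v} (Q : Finset V)
    (T : WeightedL2 m hm →L[ℂ] WeightedL2 m hm) :
    trace ((indicatorMul m hm (Q : Set V)).comp T) =
      ∑ q ∈ Q, inner ℂ (unitDelta m hm q) (T (unitDelta m hm q)) := by
  classical
  have hval : ∀ v, inner ℂ (unitDelta m hm v)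
      (((indicatorMul m hm (Q : Set V)).comp T) (unitDelta m hm v)) =
        if v ∈ Q then inner ℂ (unitDelta m hm v) (T (unitDelta m hm v)) else 0 := by
    intro v
    rw [inner_unitDelta, inner_unitDelta]
    by_cases hv : v ∈ Q
    · rw [if_pos hv]
      exact congrArg (fun z => _ * toC m hm v z) (if_pos (Finset.mem_coe.2 hv))
    · rw [if_neg hv, mul_eq_zero]
      refine Or.inr (congrArg (toC m hm v) (if_neg fun h => hv (Finset.mem_coe.1 h)))
  rw [trace, tsum_eq_sum (s := Q) fun v hv => by rw [hval, if_neg hv]]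
  exact Finset.sum_congr rfl fun v hv => by rw [hval, if_pos hv]

theorem IDS_eq (Q : Finset V) (E : ℝ) : IDS G hdeg Q E = (Q.card : ℝ)⁻¹ *
    ∑ q ∈ Q, ‖(spectralIic (lapL2 G hdeg) E).starProjection (unitDelta _ _ q)‖ ^ 2 := by
  rw [IDS, trace_indicatorMul_comp, spectralProjIic_eq]
  simp only [inner_self_starProjection]
  rw [← Complex.ofReal_sum, Complex.ofReal_re]

variable {d : ℕ} [AddAction (Fin d → ℤ) V] {Q : Finset V}

/-- The integrated density of states is continuous exactly away from the `ℓ²`-eigenvalues. -/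
theorem continuousAt_IDS_iff (hG : IsPeriodic d G) (hQ : IsFundamentalDomain d Q) (E : ℝ) :
    ContinuousAt (IDS G hdeg Q) E ↔ lapEigenspace G hdeg (E : ℂ) = ⊥ := by
  have hA := isSelfAdjoint_lapL2 G hdeg
  have hIDS : IDS G hdeg Q = fun E => (Q.card : ℝ)⁻¹ *
    ∑ q ∈ Q, ‖(spectralIic (lapL2 G hdeg) E).starProjection (unitDelta _ _ q)‖ ^ 2 :=
    funext (IDS_eq Q)
  constructor
  · intro hcont
    by_contra hne
    obtain ⟨q, hq, hqne⟩ := exists_starProjection_unitDelta_ne_zero hG hQ hne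
    -- The density of the eigenprojection per vertex of `Q`: a positive lower bound for the jump of
    -- `N_G` at `E`.
    set c : ℝ := (Q.card : ℝ)⁻¹ *
      ∑ q ∈ Q, ‖(lapEigenspace G hdeg (E : ℂ)).starProjection (unitDelta _ _ q)‖ ^ 2 with hc
    have hcpos : 0 < c := by
      refine mul_pos (inv_pos.2 (Nat.cast_pos.2 (Finset.card_pos.2 ⟨q, hq⟩))) ?_
      exact Finset.sum_pos' (fun _ _ => sq_nonneg _) ⟨q, hq, pow_pos (norm_pos_iff.2 hqne) 2⟩
    have hjump : ∀ E' < E, IDS G hdeg Q E' ≤ IDS G hdeg Q E - c := by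
      intro E' hE'
      rw [le_sub_iff_add_le, hc, IDS_eq, IDS_eq, ← mul_add, ← Finset.sum_add_distrib]
      gcongr with q hq
      exact norm_sq_add_norm_sq_le_spectralIic hA hE' _
    have hlim : Filter.Tendsto (IDS G hdeg Q) (nhdsWithin E (Set.Iio E))
        (nhds (IDS G hdeg Q E)) := hcont.tendsto.mono_left nhdsWithin_le_nhds
    have := le_of_tendsto hlim (Filter.eventually_of_mem self_mem_nhdsWithin hjump)
    linarith
  · intro hbot
    rw [hIDS]
    refine continuousAt_const.mul ?_
    refine tendsto_finsetSum _ fun q _ => ?_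
    exact ((continuousAt_spectralIic hA hbot _).norm.pow 2)

end IDS

end PeriodicGraph

theorem mainTheorem2 {V : Type*} [Infinite V] {d : ℕ} [AddAction (Fin d → ℤ) V]
    (G : SimpleGraph V) [G.LocallyFinite] (hdeg : ∀ v, 0 < G.degree v)
    (hG : PeriodicGraph.IsPeriodic d G)
    (Q : Finset V) (hQ : PeriodicGraph.IsFundamentalDomain d Q) (E : ℝ) :
    List.TFAE [
      ContinuousAt (PeriodicGraph.IDS G hdeg Q) E,
      ¬ ∃ f : V → ℂ, f ≠ 0 ∧ (Function.support f).Finite ∧ PeriodicGraph.lap G f = (E : ℂ) • f,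
      ¬ ∃ f : V → ℂ, f ≠ 0 ∧ Memℓp f 2 ∧ PeriodicGraph.lap G f = (E : ℂ) • f,
      ∃ θ : PeriodicGraph.Torus d, (E : ℂ) ∉ spectrum ℂ (PeriodicGraph.floquetLap hG θ)] := by
  have hL2 := PeriodicGraph.exists_memlp_eigenfunction_iff (hdeg := hdeg) hG hQ (E : ℂ)
  tfae_have 1 ↔ 3 := by
    rw [hL2, not_not]
    exact PeriodicGraph.continuousAt_IDS_iff hG hQ E
  tfae_have 2 → 3 := fun h h3 =>
    h (PeriodicGraph.exists_finite_support_of_lapEigenspace_ne_bot hG hQ (hL2.1 h3))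
  tfae_have 3 → 2 := fun h ⟨f, hf0, hfin, hf⟩ =>
    h ⟨f, hf0, (memℓp_zero hfin).of_exponent_ge zero_le, hf⟩
  tfae_have 2 ↔ 4 := PeriodicGraph.not_exists_finite_support_iff hG hQ (E : ℂ)
  tfae_finish
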